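/- Let $M$ be a smooth (Hausdorff) manifold with a smooth semi-Riemannian metric $g$ of signature $(p,q)$, let $\mathbb{R}^{p,q}$ be $\mathbb{R}^{p+q}$ with the standard bilinear form $\eta$ of signature $(p,q)$, and let $FM\to M$ be the principal $\mathrm{O}(p,q)$ bundle whose points over $x$ are the linear isometries $\mathbb{R}^{p,q}\to T_xM$ (orthonormal frames). The Poincaré 2-group $\mathbf{Poinc}(p,q)$ is the strict Lie 2-group whose group of objects is $\mathrm{O}(p,q)$ and whose group of morphisms is $\mathrm{O}(p,q)\ltimes\mathbb{R}^{p,q}$, where $(k,h)$ is a morphism from $k$ to $k$ and composition of morphisms is addition in $\mathbb{R}^{p,q}$. The 2-frame 2-bundle of $M$ is the associated 2-bundle $FM\times_{\mathrm{O}(p,q)}\mathbf{Poinc}(p,q)$: its spaces of objects and of morphisms are $(FM\times\mathrm{O}(p,q))/\mathrm{O}(p,q)$ and $(FM\times(\mathrm{O}(p,q)\ltimes\mathbb{R}^{p,q}))/\mathrm{O}(p,q)$, with the right action of $\mathbf{Poinc}(p,q)$ by multiplication. A local trivialization $t$ of a right $\mathbf{Poinc}(p,q)$ 2-space $P$ over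 $M$ is, over an open set $U_t\subseteq M$, a smooth isomorphism $P|_{U_t}\to U_t\times\mathbf{Poinc}(p,q)$ of 2-spaces over $U_t$ that commutes with the action; $P$ is a principal 2-bundle if the sets $U_t$ cover $M$. The transition functions $g_{tt'}:U_t\cap U_{t'}\to\mathrm{O}(p,q)$ are defined by $t(t'^{-1}(x,k))=(x,g_{tt'}(x)k)$. A strict 2-connection on a principal $\mathbf{Poinc}(p,q)$ 2-bundle consists of a smooth $\mathfrak{o}(p,q)$-valued 1-form $A_t$ and a smooth $\mathbb{R}^{p,q}$-valued 2-form $B_t$ on $U_t$ for each local trivialization $t$, such that the fake flatness condition $dA_t+A_t\wedge A_t=\underline{t}(B_t)$ holds, where $\underline{t}=0$ is the differential of the (trivial) target homomorphism $\mathbb{R}^{p,q}\to\mathrm{O}(p,q)$, and such that on $U_t\cap U_{t'}$ $$A_t=g_{tt'}A_{t'}g_{tt'}^{-1}+g_{tt'}\,d(g_{tt'}^{-1}),\qquad B_t=g_{tt'}B_{t'}.$$ It is flat if its curvature $dA_t+A_t\wedge A_t$ and its 2-curvature $dB_t+A_t\wedge B_t$ vanish for all $t$. Let $\omega$ be a smooth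 flat metric-compatible connection on $FM$, let $D$ be the corresponding covariant derivative on $TM$ (so $D$ has zero curvature and $v\,g(u,w)=g(D_vu,w)+g(u,D_vw)$), and let $T(v,w)=D_vw-D_wv-[v,w]$ be its torsion. For each local trivialization $t$ of the 2-frame 2-bundle, let $s_t$ be the local orthonormal frame on $U_t$ given by the objects $t^{-1}(x,1)$, where the class $[\varphi,k]$ of an object of the 2-frame 2-bundle is identified with the frame $\varphi\circ k$. The pair $(\omega,T)$ is given in the trivialization $t$ by $$A_t(v)\,e_a=s_t^{-1}\bigl(D_v(s_te_a)\bigr),\qquad B_t(v,w)=s_t^{-1}\bigl(T(v,w)\bigr),$$ where $(e_a)$ is the standard basis of $\mathbb{R}^{p,q}$. Then the 2-frame 2-bundle of $M$ is a principal $\mathbf{Poinc}(p,q)$ 2-bundle, and $(\omega,T)$ is a flat strict 2-connection on it. -/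

import Mathlib

open Diffeology Bundle Manifold
open scoped ContDiff

noncomputable section

namespace HigherGauge

universe u v w

/-! ### Smooth spaces

Smooth structures are diffeologies; manifolds with their smooth maps form a full subcategory of
diffeological spaces. -/

/-- The coarsest diffeology for which all the maps `f i` are smooth. -/
@[reducible] def inducedDiffeology {ι : Sort*} {X Y : Type*} [DiffeologicalSpace Y]
    (f : ι → X → Y) : DiffeologicalSpace X where
  plots n := {p | ∀ i, IsPlot (f i ∘ p)}
  constant_plots x := fun i => isPlot_const (x := f i x)
  plot_reparam hp hf := fun i => isPlot_reparam (hp i) hf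
  locality {n p} hp := fun i => DiffeologicalSpace.locality fun x => by
    obtain ⟨U, hU, hx, h⟩ := hp x
    exact ⟨U, hU, hx, fun hf hs => h hf hs i⟩

instance instDiffProd {X Y : Type*} [DiffeologicalSpace X] [DiffeologicalSpace Y] :
    DiffeologicalSpace (X × Y) where
  plots n := {p | IsPlot (fun z => (p z).1) ∧ IsPlot (fun z => (p z).2)}
  constant_plots x := ⟨isPlot_const, isPlot_const⟩
  plot_reparam hp hf := ⟨isPlot_reparam hp.1 hf, isPlot_reparam hp.2 hf⟩
  locality {n p} hp := by
    constructor <;> refine DiffeologicalSpace.locality fun x => ?_ <;>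
      obtain ⟨U, hU, hx, h⟩ := hp x
    · exact ⟨U, hU, hx, fun hf hs => (h hf hs).1⟩
    · exact ⟨U, hU, hx, fun hf hs => (h hf hs).2⟩

instance instDiffSubtype {X : Type*} [DiffeologicalSpace X] (P : X → Prop) :
    DiffeologicalSpace {x // P x} := inducedDiffeology fun _ : Unit => Subtype.val

/-- A smooth re-parametrisation of a small ball by the whole of `ℝⁿ`. -/
theorem exists_ball_reparam {n : ℕ} {U : Set (EuclideanSpace ℝ (Fin n))} (hU : IsOpen U)
    {x : EuclideanSpace ℝ (Fin n)} (hx : x ∈ U) :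
    ∃ (c d : EuclideanSpace ℝ (Fin n) → EuclideanSpace ℝ (Fin n))
      (W : Set (EuclideanSpace ℝ (Fin n))), IsOpen W ∧ x ∈ W ∧
      ContDiff ℝ ∞ c ∧ (∀ y, c y ∈ U) ∧ ContDiffOn ℝ ∞ d W ∧ ∀ y ∈ W, c (d y) = y := by
  obtain ⟨ε, hε, hb⟩ := Metric.isOpen_iff.1 hU x hx
  refine ⟨OpenPartialHomeomorph.univBall x ε, (OpenPartialHomeomorph.univBall x ε).symm,
    Metric.ball x ε, Metric.isOpen_ball, Metric.mem_ball_self hε,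
    OpenPartialHomeomorph.contDiff_univBall, ?_,
    OpenPartialHomeomorph.contDiffOn_univBall_symm, ?_⟩
  · intro y
    apply hb
    rw [← OpenPartialHomeomorph.univBall_target x hε]
    exact (OpenPartialHomeomorph.univBall x ε).map_source (by simp)
  · intro y hy
    rw [← OpenPartialHomeomorph.univBall_target x hε] at hy
    exact (OpenPartialHomeomorph.univBall x ε).right_inv hy

/-- The quotient diffeology: the plots are the maps that lift locally to plots. -/
instance instDiffQuotient {X : Type*} [DiffeologicalSpace X] (s : Setoid X) :
    DiffeologicalSpace (Quotient s) where
  plots n := {p | ∀ x, ∃ U : Set (EuclideanSpace ℝ (Fin n)), IsOpen U ∧ x ∈ U ∧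
    ∀ (m : ℕ) (f : EuclideanSpace ℝ (Fin m) → EuclideanSpace ℝ (Fin n)), (∀ y, f y ∈ U) →
      ContDiff ℝ ∞ f → ∃ q : EuclideanSpace ℝ (Fin m) → X, IsPlot q ∧
        ∀ y, p (f y) = Quotient.mk s (q y)}
  constant_plots c := fun x => ⟨Set.univ, isOpen_univ, trivial, fun m f _ _ => by
    obtain ⟨a, ha⟩ := Quotient.exists_rep c
    exact ⟨fun _ => a, isPlot_const, fun _ => ha.symm⟩⟩
  plot_reparam {n m p h} hp hh := fun x => by
    obtain ⟨U, hU, hx, H⟩ := hp (h x)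
    exact ⟨h ⁻¹' U, hU.preimage hh.continuous, hx, fun k f hf hs => H k (h ∘ f) hf (hh.comp hs)⟩
  locality {n p} hp := fun x => by
    obtain ⟨U, hU, hx, H⟩ := hp x
    obtain ⟨c, d, W, hW, hxW, hc, hcU, hd, hcd⟩ := exists_ball_reparam hU hx
    obtain ⟨U', hU', hxU', H'⟩ := H hcU hc (d x)
    refine ⟨W ∩ d ⁻¹' U', hd.continuousOn.isOpen_inter_preimage hW hU', ⟨hxW, hxU'⟩,
      fun m f hf hs => ?_⟩
    have hdf : ContDiff ℝ ∞ (d ∘ f) := contDiffOn_univ.1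
      (hd.comp hs.contDiffOn fun y _ => (hf y).1)
    obtain ⟨q, hq, hpq⟩ := H' m (d ∘ f) (fun y => (hf y).2) hdf
    exact ⟨q, hq, fun y => by rw [← hpq y]; simp [hcd _ (hf y).1]⟩

/-- The diffeology of a manifold: the plots are the smooth maps. -/
@[reducible] def manifoldDiffeology {E : Type*} [NormedAddCommGroup E] [NormedSpace ℝ E]
    {H : Type*} [TopologicalSpace H] (I : ModelWithCorners ℝ E H)
    (M : Type*) [TopologicalSpace M] [ChartedSpace H M] : DiffeologicalSpace M where
  plots n := {p | ContMDiff 𝓘(ℝ, EuclideanSpace ℝ (Fin n)) I ∞ p}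
  constant_plots x := contMDiff_const
  plot_reparam hp hf := hp.comp hf.contMDiff
  locality {n p} hp := fun x => by
    obtain ⟨U, hU, hx, H⟩ := hp x
    obtain ⟨c, d, W, hW, hxW, hc, hcU, hd, hcd⟩ := exists_ball_reparam hU hx
    have h1 : ContMDiffOn 𝓘(ℝ, EuclideanSpace ℝ (Fin n)) I ∞ ((p ∘ c) ∘ d) W :=
      (show ContMDiff _ _ _ _ from H hcU hc).comp_contMDiffOn hd.contMDiffOn
    have h2 : ContMDiffOn 𝓘(ℝ, EuclideanSpace ℝ (Fin n)) I ∞ p W :=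
      h1.congr fun y hy => by simp [hcd y hy]
    exact h2.contMDiffAt (hW.mem_nhds hxW)

/-! ### Groupoids, 2-groups, 2-bundles -/

/-- A groupoid in smooth spaces; `comp f g` is `f ∘ g`. -/
structure SmoothGroupoid where
  Ob : Type u
  Mor : Type u
  [diffOb : DiffeologicalSpace Ob]
  [diffMor : DiffeologicalSpace Mor]
  src : Mor → Ob
  tgt : Mor → Ob
  ident : Ob → Mor
  inv : Mor → Mor
  comp : (f g : Mor) → src f = tgt g → Mor
  src_ident : ∀ a, src (ident a) = a
  tgt_ident : ∀ a, tgt (ident a) = a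
  src_inv : ∀ f, src (inv f) = tgt f
  tgt_inv : ∀ f, tgt (inv f) = src f
  src_comp : ∀ f g h, src (comp f g h) = src g
  tgt_comp : ∀ f g h, tgt (comp f g h) = tgt f
  ident_comp : ∀ f, comp (ident (tgt f)) f (src_ident _) = f
  comp_ident : ∀ f, comp f (ident (src f)) (tgt_ident _).symm = f
  inv_comp : ∀ f, comp (inv f) f (src_inv f) = ident (src f)
  comp_inv : ∀ f, comp f (inv f) (tgt_inv f).symm = ident (tgt f)
  assoc : ∀ (f g k : Mor) (h₁ : src f = tgt g) (h₂ : src g = tgt k),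
    comp (comp f g h₁) k ((src_comp f g h₁).trans h₂) =
      comp f (comp g k h₂) (h₁.trans (tgt_comp g k h₂).symm)
  smooth_src : DSmooth src
  smooth_tgt : DSmooth tgt
  smooth_ident : DSmooth ident
  smooth_inv : DSmooth inv
  smooth_comp : DSmooth fun z : {z : Mor × Mor // src z.1 = tgt z.2} => comp z.1.1 z.1.2 z.2

attribute [instance] SmoothGroupoid.diffOb SmoothGroupoid.diffMor

/-- A strict (smooth) 2-group: a groupoid whose objects and morphisms form groups, such that
multiplication and inversion are smooth functors. -/
structure Smooth2Group extends SmoothGroupoid.{u} where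
  [groupOb : Group Ob]
  [groupMor : Group Mor]
  src_mul : ∀ f g : Mor, src (f * g) = src f * src g
  tgt_mul : ∀ f g : Mor, tgt (f * g) = tgt f * tgt g
  ident_mul : ∀ a b : Ob, ident (a * b) = ident a * ident b
  comp_mul : ∀ (f g f' g' : Mor) (h : src f = tgt g) (h' : src f' = tgt g'),
    comp (f * f') (g * g') (by rw [src_mul, tgt_mul, h, h']) = comp f g h * comp f' g' h'
  smooth_mulOb : DSmooth fun z : Ob × Ob => z.1 * z.2
  smooth_mulMor : DSmooth fun z : Mor × Mor => z.1 * z.2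
  smooth_invOb : DSmooth fun a : Ob => a⁻¹
  smooth_invMor : DSmooth fun f : Mor => f⁻¹

attribute [instance] Smooth2Group.groupOb Smooth2Group.groupMor

/-- A right 2-space of a 2-group `𝔾` with a `𝔾`-invariant projection to a space `M`, which is
regarded as a groupoid with only identity morphisms. -/
structure TwoSpaceOver (𝔾 : Smooth2Group.{v}) (M : Type w) [DiffeologicalSpace M]
    extends SmoothGroupoid.{u} where
  proj : Ob → M
  proj_tgt : ∀ f, proj (tgt f) = proj (src f)
  smooth_proj : DSmooth proj
  actOb : Ob → 𝔾.Ob → Ob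
  actMor : Mor → 𝔾.Mor → Mor
  actOb_one : ∀ a, actOb a 1 = a
  actOb_mul : ∀ a g h, actOb a (g * h) = actOb (actOb a g) h
  actMor_one : ∀ f, actMor f 1 = f
  actMor_mul : ∀ f g h, actMor f (g * h) = actMor (actMor f g) h
  src_act : ∀ f g, src (actMor f g) = actOb (src f) (𝔾.src g)
  tgt_act : ∀ f g, tgt (actMor f g) = actOb (tgt f) (𝔾.tgt g)
  ident_act : ∀ a g, ident (actOb a g) = actMor (ident a) (𝔾.ident g)
  comp_act : ∀ (f f' : Mor) (g g' : 𝔾.Mor) (h : src f = tgt f') (h' : 𝔾.src g = 𝔾.tgt g'),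
    comp (actMor f g) (actMor f' g') (by rw [src_act, tgt_act, h, h']) =
      actMor (comp f f' h) (𝔾.comp g g' h')
  proj_act : ∀ a g, proj (actOb a g) = proj a
  smooth_actOb : DSmooth fun z : Ob × 𝔾.Ob => actOb z.1 z.2
  smooth_actMor : DSmooth fun z : Mor × 𝔾.Mor => actMor z.1 z.2

/-- A local trivialization of `P` over an open set `U`: an isomorphism of right `𝔾` 2-spaces
from `P|_U` to `U × 𝔾` which commutes with the projections to `U`. -/
structure LocalTriv {𝔾 : Smooth2Group.{v}} {M : Type w} [TopologicalSpace M] [DiffeologicalSpace M]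
    (P : TwoSpaceOver.{u} 𝔾 M) where
  U : Set M
  isOpen : IsOpen U
  onOb : {a : P.Ob // P.proj a ∈ U} ≃ {x : M // x ∈ U} × 𝔾.Ob
  onMor : {f : P.Mor // P.proj (P.src f) ∈ U} ≃ {x : M // x ∈ U} × 𝔾.Mor
  smooth_onOb : DSmooth onOb
  smooth_onOb_symm : DSmooth onOb.symm
  smooth_onMor : DSmooth onMor
  smooth_onMor_symm : DSmooth onMor.symm
  proj_onOb : ∀ a, ((onOb a).1 : M) = P.proj a.1
  proj_onMor : ∀ f, ((onMor f).1 : M) = P.proj (P.src f.1)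
  src_onMor : ∀ f, 𝔾.src (onMor f).2 = (onOb ⟨P.src f.1, f.2⟩).2
  tgt_onMor : ∀ f, 𝔾.tgt (onMor f).2 = (onOb ⟨P.tgt f.1, (P.proj_tgt f.1).symm ▸ f.2⟩).2
  ident_onMor : ∀ a, (onMor ⟨P.ident a.1, (P.src_ident a.1).symm ▸ a.2⟩).2 = 𝔾.ident (onOb a).2
  comp_onMor : ∀ (f f' : {f : P.Mor // P.proj (P.src f) ∈ U}) (h : P.src f.1 = P.tgt f'.1)
    (h' : 𝔾.src (onMor f).2 = 𝔾.tgt (onMor f').2),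
    (onMor ⟨P.comp f.1 f'.1 h, (P.src_comp f.1 f'.1 h).symm ▸ f'.2⟩).2 =
      𝔾.comp (onMor f).2 (onMor f').2 h'
  act_onOb : ∀ a (g : 𝔾.Ob),
    (onOb ⟨P.actOb a.1 g, (P.proj_act a.1 g).symm ▸ a.2⟩).2 = (onOb a).2 * g
  act_onMor : ∀ f (g : 𝔾.Mor),
    (onMor ⟨P.actMor f.1 g, by rw [P.src_act, P.proj_act]; exact f.2⟩).2 = (onMor f).2 * g

/-- A right `𝔾` 2-space over `M` is a principal `𝔾` 2-bundle if it is locally trivial. -/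
def TwoSpaceOver.IsPrincipal2Bundle {𝔾 : Smooth2Group.{v}} {M : Type w} [TopologicalSpace M]
    [DiffeologicalSpace M] (P : TwoSpaceOver.{u} 𝔾 M) : Prop :=
  ∀ x : M, ∃ t : LocalTriv P, x ∈ t.U

/-- The object `t⁻¹(x, 1)`; it is defined for `x` in the domain of `t`. -/
def LocalTriv.sect {𝔾 : Smooth2Group.{v}} {M : Type w} [TopologicalSpace M] [DiffeologicalSpace M]
    {P : TwoSpaceOver.{u} 𝔾 M} (t : LocalTriv P) (x : M) (hx : x ∈ t.U) : P.Ob :=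
  (t.onOb.symm (⟨x, hx⟩, 1)).1

theorem LocalTriv.proj_sect {𝔾 : Smooth2Group.{v}} {M : Type w} [TopologicalSpace M]
    [DiffeologicalSpace M] {P : TwoSpaceOver.{u} 𝔾 M} (t : LocalTriv P) (x : M) (hx : x ∈ t.U) :
    P.proj (t.sect x hx) = x := by
  have := t.proj_onOb (t.onOb.symm (⟨x, hx⟩, 1))
  simpa [LocalTriv.sect] using this.symm

open Classical in
/-- The transition function `g_{tt'}` on the overlap, `t (t'⁻¹ (x, h)) = (x, g_{tt'}(x) h)`,
extended by `1`. -/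
def LocalTriv.transition {𝔾 : Smooth2Group.{v}} {M : Type w} [TopologicalSpace M]
    [DiffeologicalSpace M] {P : TwoSpaceOver.{u} 𝔾 M} (t t' : LocalTriv P) (x : M) : 𝔾.Ob :=
  if h : x ∈ t.U ∧ x ∈ t'.U then
    (t.onOb ⟨t'.sect x h.2, (t'.proj_sect x h.2).symm ▸ h.1⟩).2
  else 1

/-! ### The associated 2-bundle -/

/-- A smooth space `P` over `M` with a right action of `G` that is free and transitive on each
fibre, with smooth division map. -/
structure PrincipalSpace (G : Type v) [Group G] [DiffeologicalSpace G]
    (M : Type w) [DiffeologicalSpace M] where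
  P : Type u
  [diff : DiffeologicalSpace P]
  proj : P → M
  act : P → G → P
  div : (a b : P) → proj a = proj b → G
  act_one : ∀ a, act a 1 = a
  act_mul : ∀ a g h, act a (g * h) = act (act a g) h
  proj_act : ∀ a g, proj (act a g) = proj a
  act_div : ∀ a b h, act a (div a b h) = b
  free : ∀ a g h, act a g = act a h → g = h
  smooth_proj : DSmooth proj
  smooth_act : DSmooth fun z : P × G => act z.1 z.2
  smooth_div : DSmooth fun z : {z : P × P // proj z.1 = proj z.2} => div z.1.1 z.1.2 z.2

attribute [instance] PrincipalSpace.diff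

namespace PrincipalSpace

variable {𝔾 : Smooth2Group.{v}} {M : Type w} [DiffeologicalSpace M]
  (P : PrincipalSpace.{u} 𝔾.Ob M)

/-- The relation `(x g, a) ∼ (x, g a)` on `P × 𝔾₀`. -/
def setoidOb : Setoid (P.P × 𝔾.Ob) where
  r z z' := ∃ g : 𝔾.Ob, z'.1 = P.act z.1 g ∧ z.2 = g * z'.2
  iseqv :=
    { refl := fun z => ⟨1, by simp [P.act_one]⟩
      symm := by
        rintro ⟨x, a⟩ ⟨y, b⟩ ⟨g, h1, h2⟩
        exact ⟨g⁻¹, by simp_all [← P.act_mul, P.act_one], by simp_all⟩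
      trans := by
        rintro ⟨x, a⟩ ⟨y, b⟩ ⟨z, c⟩ ⟨g, h1, h2⟩ ⟨k, h3, h4⟩
        exact ⟨g * k, by simp_all [P.act_mul], by simp_all [mul_assoc]⟩ }

theorem ident_one : 𝔾.ident 1 = 1 := by
  have h := 𝔾.ident_mul 1 1
  rw [mul_one] at h
  exact (mul_eq_left.1 h.symm)

theorem ident_inv (g : 𝔾.Ob) : 𝔾.ident g⁻¹ = (𝔾.ident g)⁻¹ := by
  rw [eq_inv_iff_mul_eq_one, ← 𝔾.ident_mul, inv_mul_cancel, ident_one]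

/-- The relation `(x g, f) ∼ (x, 1_g f)` on `P × 𝔾₁`. -/
def setoidMor : Setoid (P.P × 𝔾.Mor) where
  r z z' := ∃ g : 𝔾.Ob, z'.1 = P.act z.1 g ∧ z.2 = 𝔾.ident g * z'.2
  iseqv :=
    { refl := fun z => ⟨1, by simp [P.act_one, ident_one]⟩
      symm := by
        rintro ⟨x, a⟩ ⟨y, b⟩ ⟨g, h1, h2⟩
        exact ⟨g⁻¹, by simp_all [← P.act_mul, P.act_one], by simp_all [ident_inv]⟩
      trans := by
        rintro ⟨x, a⟩ ⟨y, b⟩ ⟨z, c⟩ ⟨g, h1, h2⟩ ⟨k, h3, h4⟩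
        exact ⟨g * k, by simp_all [P.act_mul], by simp_all [𝔾.ident_mul, mul_assoc]⟩ }

/-- Objects of `P ×_G 𝔾`. -/
abbrev AssocOb : Type (max u v) := Quotient P.setoidOb

/-- Morphisms of `P ×_G 𝔾`. -/
abbrev AssocMor : Type (max u v) := Quotient P.setoidMor

abbrev mkOb (x : P.P) (a : 𝔾.Ob) : P.AssocOb := Quotient.mk _ (x, a)

abbrev mkMor (x : P.P) (f : 𝔾.Mor) : P.AssocMor := Quotient.mk _ (x, f)

theorem mkOb_act (x : P.P) (g a : 𝔾.Ob) : P.mkOb (P.act x g) a = P.mkOb x (g * a) :=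
  (Quotient.sound (s := P.setoidOb) ⟨g, rfl, rfl⟩).symm

theorem mkMor_act (x : P.P) (g : 𝔾.Ob) (f : 𝔾.Mor) :
    P.mkMor (P.act x g) f = P.mkMor x (𝔾.ident g * f) :=
  (Quotient.sound (s := P.setoidMor) ⟨g, rfl, rfl⟩).symm

def assocSrc : P.AssocMor → P.AssocOb :=
  Quotient.map (fun z => (z.1, 𝔾.src z.2)) fun _ _ ⟨g, h1, h2⟩ =>
    ⟨g, h1, by simp [h2, 𝔾.src_mul, 𝔾.src_ident]⟩

def assocTgt : P.AssocMor → P.AssocOb :=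
  Quotient.map (fun z => (z.1, 𝔾.tgt z.2)) fun _ _ ⟨g, h1, h2⟩ =>
    ⟨g, h1, by simp [h2, 𝔾.tgt_mul, 𝔾.tgt_ident]⟩

def assocIdent : P.AssocOb → P.AssocMor :=
  Quotient.map (fun z => (z.1, 𝔾.ident z.2)) fun _ _ ⟨g, h1, h2⟩ =>
    ⟨g, h1, by simp [h2, 𝔾.ident_mul]⟩

theorem mkOb_eq {x y : P.P} {a b : 𝔾.Ob} (h : P.mkOb x a = P.mkOb y b) :
    ∃ g : 𝔾.Ob, y = P.act x g ∧ a = g * b :=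
  Quotient.exact (s := P.setoidOb) h

theorem mkOb_inj {x : P.P} {a b : 𝔾.Ob} (h : P.mkOb x a = P.mkOb x b) : a = b := by
  obtain ⟨g, h1, h2⟩ := P.mkOb_eq h
  have : g = 1 := P.free x _ _ (by rw [← h1, P.act_one])
  simpa [this] using h2

theorem comp_congr {f f' k k' : 𝔾.Mor} (hf : f = f') (hk : k = k') (h : 𝔾.src f = 𝔾.tgt k)
    (h' : 𝔾.src f' = 𝔾.tgt k') : 𝔾.comp f k h = 𝔾.comp f' k' h' := by
  subst hf hk; rfl

/-- Multiplying by an identity morphism preserves composites. -/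
theorem ident_mul_comp (g : 𝔾.Ob) (f k : 𝔾.Mor) (h : 𝔾.src f = 𝔾.tgt k) :
    𝔾.ident g * 𝔾.comp f k h = 𝔾.comp (𝔾.ident g * f) (𝔾.ident g * k)
      (by rw [𝔾.src_mul, 𝔾.tgt_mul, 𝔾.src_ident, 𝔾.tgt_ident, h]) := by
  have hg : 𝔾.src (𝔾.ident g) = 𝔾.tgt (𝔾.ident g) := by rw [𝔾.src_ident, 𝔾.tgt_ident]
  rw [𝔾.comp_mul (𝔾.ident g) (𝔾.ident g) f k hg h]
  congr 1
  have := 𝔾.comp_ident (𝔾.ident g)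
  conv_lhs => rw [← this]
  exact comp_congr rfl (by rw [𝔾.src_ident]) _ _

/-- Two morphisms with matching ends have representatives with the same frame. -/
theorem exists_rep (α β : P.AssocMor) (h : P.assocSrc α = P.assocTgt β) :
    ∃ (x : P.P) (f k : 𝔾.Mor), 𝔾.src f = 𝔾.tgt k ∧ α = P.mkMor x f ∧ β = P.mkMor x k := by
  obtain ⟨⟨x, f⟩, rfl⟩ := Quotient.exists_rep α
  obtain ⟨⟨y, k⟩, rfl⟩ := Quotient.exists_rep β
  obtain ⟨g, h1, h2⟩ := P.mkOb_eq (x := x) (y := y) (a := 𝔾.src f) (b := 𝔾.tgt k) h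
  subst h1
  exact ⟨x, f, 𝔾.ident g * k, by rw [𝔾.tgt_mul, 𝔾.tgt_ident, ← h2], rfl, P.mkMor_act x g k⟩

/-- Composition: `[x, f] ∘ [x, k] = [x, f ∘ k]`. -/
def assocComp (α β : P.AssocMor) (h : P.assocSrc α = P.assocTgt β) : P.AssocMor :=
  P.mkMor (P.exists_rep α β h).choose (𝔾.comp (P.exists_rep α β h).choose_spec.choose
    (P.exists_rep α β h).choose_spec.choose_spec.choose
    (P.exists_rep α β h).choose_spec.choose_spec.choose_spec.1)

theorem assocComp_mk (x : P.P) (f k : 𝔾.Mor) (h : 𝔾.src f = 𝔾.tgt k)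
    (h' : P.assocSrc (P.mkMor x f) = P.assocTgt (P.mkMor x k)) :
    P.assocComp (P.mkMor x f) (P.mkMor x k) h' = P.mkMor x (𝔾.comp f k h) := by
  have H := P.exists_rep (P.mkMor x f) (P.mkMor x k) h'
  have key : ∀ (y : P.P) (f' k' : 𝔾.Mor) (hh : 𝔾.src f' = 𝔾.tgt k'),
      P.mkMor x f = P.mkMor y f' → P.mkMor x k = P.mkMor y k' →
      P.mkMor y (𝔾.comp f' k' hh) = P.mkMor x (𝔾.comp f k h) := by
    intro y f' k' hh e1 e2
    obtain ⟨g, h1, h2⟩ := Quotient.exact (s := P.setoidMor) e1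
    obtain ⟨g', h1', h2'⟩ := Quotient.exact (s := P.setoidMor) e2
    simp only at h1 h2 h1' h2'
    have hg : g = g' := P.free x _ _ (h1.symm.trans h1')
    subst hg h1
    rw [P.mkMor_act, ident_mul_comp]
    congr 1
    exact comp_congr h2.symm h2'.symm _ _
  exact key _ _ _ (P.exists_rep _ _ h').choose_spec.choose_spec.choose_spec.1
    (P.exists_rep _ _ h').choose_spec.choose_spec.choose_spec.2.1
    (P.exists_rep _ _ h').choose_spec.choose_spec.choose_spec.2.2

theorem assocComp_congr {α α' β β' : P.AssocMor} (hα : α = α') (hβ : β = β')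
    (h : P.assocSrc α = P.assocTgt β) (h' : P.assocSrc α' = P.assocTgt β') :
    P.assocComp α β h = P.assocComp α' β' h' := by
  subst hα hβ; rfl

theorem mk_src_tgt {x : P.P} {f k : 𝔾.Mor}
    (h : P.assocSrc (P.mkMor x f) = P.assocTgt (P.mkMor x k)) : 𝔾.src f = 𝔾.tgt k :=
  P.mkOb_inj h

/-- A map out of a quotient is smooth if its composite with the projection is. -/
theorem dSmooth_quotient {X Y : Type*} [DiffeologicalSpace X] [DiffeologicalSpace Y]
    {s : Setoid X} {F : Quotient s → Y} (h : DSmooth fun x => F (Quotient.mk s x)) :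
    DSmooth F := fun n p hp => DiffeologicalSpace.locality fun x => by
  obtain ⟨U, hU, hx, H⟩ := hp x
  refine ⟨U, hU, hx, fun {m f} hf hs => ?_⟩
  obtain ⟨q, hq, e⟩ := H m f hf hs
  have : (F ∘ p) ∘ f = (fun x => F (Quotient.mk s x)) ∘ q := by
    funext y; simp [e y]
  rw [this]
  exact h m q hq

theorem dSmooth_mk {X : Type*} [DiffeologicalSpace X] {s : Setoid X} :
    DSmooth (Quotient.mk s) := fun _ p hp _ =>
  ⟨Set.univ, isOpen_univ, trivial, fun _ f _ hs => ⟨p ∘ f, isPlot_reparam hp hs, fun _ => rfl⟩⟩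

theorem dSmooth_fst {X Y : Type*} [DiffeologicalSpace X] [DiffeologicalSpace Y] :
    DSmooth (Prod.fst : X × Y → X) := fun _ _ hp => hp.1

theorem dSmooth_snd {X Y : Type*} [DiffeologicalSpace X] [DiffeologicalSpace Y] :
    DSmooth (Prod.snd : X × Y → Y) := fun _ _ hp => hp.2

theorem dSmooth_prodMk {X Y Z : Type*} [DiffeologicalSpace X] [DiffeologicalSpace Y]
    [DiffeologicalSpace Z] {f : Z → X} {g : Z → Y} (hf : DSmooth f) (hg : DSmooth g) :
    DSmooth fun z => (f z, g z) := fun n p hp => ⟨hf n p hp, hg n p hp⟩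

theorem dSmooth_val {X : Type*} [DiffeologicalSpace X] {Q : X → Prop} :
    DSmooth (Subtype.val : {x // Q x} → X) := fun _ _ hp => hp ()

theorem dSmooth_subtypeMk {X Z : Type*} [DiffeologicalSpace X] [DiffeologicalSpace Z]
    {Q : X → Prop} {f : Z → X} (hf : DSmooth f) (h : ∀ z, Q (f z)) :
    DSmooth fun z => (⟨f z, h z⟩ : {x // Q x}) := fun n p hp _ => hf n p hp

/-- The smooth groupoid `P ×_G 𝔾`, where `G = 𝔾₀` acts on `𝔾` by left multiplication. -/
def assocGroupoid : SmoothGroupoid.{max u v} where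
  Ob := P.AssocOb
  Mor := P.AssocMor
  src := P.assocSrc
  tgt := P.assocTgt
  ident := P.assocIdent
  inv := Quotient.map (fun z => (z.1, 𝔾.inv z.2)) fun z z' ⟨g, h1, h2⟩ => ⟨g, h1, by
    simp only [h2]
    have e1 : 𝔾.src (𝔾.ident g * 𝔾.inv z'.2) = 𝔾.tgt (𝔾.ident g * z'.2) := by
      rw [𝔾.src_mul, 𝔾.tgt_mul, 𝔾.src_ident, 𝔾.tgt_ident, 𝔾.src_inv]
    have e2 : 𝔾.comp (𝔾.ident g * 𝔾.inv z'.2) (𝔾.ident g * z'.2) e1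
        = 𝔾.ident (𝔾.src (𝔾.ident g * z'.2)) := by
      rw [← ident_mul_comp _ _ _ (𝔾.src_inv _), 𝔾.inv_comp, ← 𝔾.ident_mul, 𝔾.src_mul, 𝔾.src_ident]
    have e3 := 𝔾.assoc (𝔾.ident g * 𝔾.inv z'.2) (𝔾.ident g * z'.2)
      (𝔾.inv (𝔾.ident g * z'.2)) e1 (𝔾.tgt_inv _).symm
    have e4 := 𝔾.ident_comp (𝔾.inv (𝔾.ident g * z'.2))
    have e5 := 𝔾.comp_ident (𝔾.ident g * 𝔾.inv z'.2)
    rw [← e4, ← e5]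
    refine (comp_congr ?_ rfl _ _).trans (e3.trans (comp_congr rfl ?_ _ _))
    · rw [e2, 𝔾.tgt_inv]
    · rw [𝔾.comp_inv, e1]⟩
  comp := P.assocComp
  src_ident := by rintro ⟨x, a⟩; exact congrArg (P.mkOb x) (𝔾.src_ident a)
  tgt_ident := by rintro ⟨x, a⟩; exact congrArg (P.mkOb x) (𝔾.tgt_ident a)
  src_inv := by rintro ⟨x, a⟩; exact congrArg (P.mkOb x) (𝔾.src_inv a)
  tgt_inv := by rintro ⟨x, a⟩; exact congrArg (P.mkOb x) (𝔾.tgt_inv a)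
  src_comp α β h := by
    obtain ⟨x, f, k, hfk, rfl, rfl⟩ := P.exists_rep α β h
    rw [P.assocComp_mk x f k hfk]
    exact congrArg (P.mkOb x) (𝔾.src_comp f k hfk)
  tgt_comp α β h := by
    obtain ⟨x, f, k, hfk, rfl, rfl⟩ := P.exists_rep α β h
    rw [P.assocComp_mk x f k hfk]
    exact congrArg (P.mkOb x) (𝔾.tgt_comp f k hfk)
  ident_comp := by
    rintro ⟨x, f⟩
    exact (P.assocComp_mk x (𝔾.ident (𝔾.tgt f)) f (𝔾.src_ident _) _).trans
      (congrArg (P.mkMor x) (𝔾.ident_comp f))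
  comp_ident := by
    rintro ⟨x, f⟩
    exact (P.assocComp_mk x f (𝔾.ident (𝔾.src f)) (𝔾.tgt_ident _).symm _).trans
      (congrArg (P.mkMor x) (𝔾.comp_ident f))
  inv_comp := by
    rintro ⟨x, f⟩
    exact (P.assocComp_mk x (𝔾.inv f) f (𝔾.src_inv f) _).trans
      (congrArg (P.mkMor x) (𝔾.inv_comp f))
  comp_inv := by
    rintro ⟨x, f⟩
    exact (P.assocComp_mk x f (𝔾.inv f) (𝔾.tgt_inv f).symm _).trans
      (congrArg (P.mkMor x) (𝔾.comp_inv f))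
  assoc α β γ h₁ h₂ := by
    obtain ⟨x, f, k, hfk, rfl, rfl⟩ := P.exists_rep α β h₁
    obtain ⟨⟨y, l⟩, rfl⟩ := Quotient.exists_rep γ
    obtain ⟨g, h1, h2⟩ := P.mkOb_eq (x := x) (y := y) (a := 𝔾.src k) (b := 𝔾.tgt l) h₂
    subst h1
    have hl : Quotient.mk P.setoidMor (P.act x g, l) = P.mkMor x (𝔾.ident g * l) :=
      P.mkMor_act x g l
    generalize Quotient.mk P.setoidMor (P.act x g, l) = γ at *
    subst hl
    have hk := P.mk_src_tgt h₂
    have c1 := P.assocComp_mk x f k hfk h₁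
    have c2 := P.assocComp_mk x k _ hk h₂
    have s1 : 𝔾.src (𝔾.comp f k hfk) = 𝔾.tgt (𝔾.ident g * l) := (𝔾.src_comp ..).trans hk
    have s2 : 𝔾.src f = 𝔾.tgt (𝔾.comp k (𝔾.ident g * l) hk) := hfk.trans (𝔾.tgt_comp ..).symm
    have d1 := P.assocComp_mk x (𝔾.comp f k hfk) (𝔾.ident g * l) s1 (congrArg (P.mkOb x) s1)
    have d2 := P.assocComp_mk x f (𝔾.comp k (𝔾.ident g * l) hk) s2 (congrArg (P.mkOb x) s2)
    refine (P.assocComp_congr (β' := P.mkMor x (𝔾.ident g * l)) c1 rfl _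
      (congrArg (P.mkOb x) s1)).trans (d1.trans ?_)
    rw [𝔾.assoc f k _ hfk hk]
    exact d2.symm.trans (P.assocComp_congr rfl c2.symm _ _)
  smooth_src := dSmooth_quotient (dSmooth_mk.comp
    (dSmooth_prodMk dSmooth_fst (𝔾.smooth_src.comp dSmooth_snd)))
  smooth_tgt := dSmooth_quotient (dSmooth_mk.comp
    (dSmooth_prodMk dSmooth_fst (𝔾.smooth_tgt.comp dSmooth_snd)))
  smooth_ident := dSmooth_quotient (dSmooth_mk.comp
    (dSmooth_prodMk dSmooth_fst (𝔾.smooth_ident.comp dSmooth_snd)))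
  smooth_inv := dSmooth_quotient (dSmooth_mk.comp
    (dSmooth_prodMk dSmooth_fst (𝔾.smooth_inv.comp dSmooth_snd)))
  smooth_comp n p hp z := by
    obtain ⟨hp1, hp2⟩ := hp ()
    obtain ⟨U, hU, hz, H⟩ := hp1 z
    obtain ⟨U', hU', hz', H'⟩ := hp2 z
    refine ⟨U ∩ U', hU.inter hU', ⟨hz, hz'⟩, fun m c hc hs => ?_⟩
    obtain ⟨q, hq, e⟩ := H m c (fun y => (hc y).1) hs
    obtain ⟨q', hq', e'⟩ := H' m c (fun y => (hc y).2) hs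
    simp only [Function.comp] at e e'
    have hpr : ∀ y, P.proj (q y).1 = P.proj (q' y).1 := fun y => by
      have h := (p (c y)).2
      rw [e y, e' y] at h
      obtain ⟨g, h1, -⟩ := P.mkOb_eq (x := (q y).1) (y := (q' y).1) h
      rw [h1, P.proj_act]
    set d : EuclideanSpace ℝ (Fin m) → 𝔾.Ob := fun y => P.div _ _ (hpr y) with hd
    have hdp : IsPlot d :=
      P.smooth_div m (fun y => ⟨((q y).1, (q' y).1), hpr y⟩) fun _ => ⟨hq.1, hq'.1⟩
    have hq2 : ∀ y, (p (c y)).1.2 = P.mkMor (q y).1 (𝔾.ident (d y) * (q' y).2) := fun y => by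
      rw [← P.mkMor_act, P.act_div]; exact e' y
    have hm : ∀ y, 𝔾.src (q y).2 = 𝔾.tgt (𝔾.ident (d y) * (q' y).2) := fun y => by
      have h := (p (c y)).2
      rw [e y, hq2 y] at h
      exact P.mk_src_tgt h
    have hk : IsPlot fun y => 𝔾.ident (d y) * (q' y).2 :=
      𝔾.smooth_mulMor m (fun y => (𝔾.ident (d y), (q' y).2)) ⟨𝔾.smooth_ident m d hdp, hq'.2⟩
    refine ⟨fun y => ((q y).1, 𝔾.comp (q y).2 (𝔾.ident (d y) * (q' y).2) (hm y)),
      ⟨hq.1, 𝔾.smooth_comp m (fun y => ⟨((q y).2, 𝔾.ident (d y) * (q' y).2), hm y⟩)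
        fun _ => ⟨hq.2, hk⟩⟩, fun y => ?_⟩
    exact (P.assocComp_congr (α' := P.mkMor (q y).1 (q y).2) (e y) (hq2 y) (p (c y)).2
      (congrArg (P.mkOb (q y).1) (hm y))).trans (P.assocComp_mk (q y).1 _ _ (hm y) _)

/-- The right action on objects, `[x, b] a = [x, b a]`. -/
def assocActOb (α : P.AssocOb) (a : 𝔾.Ob) : P.AssocOb :=
  Quotient.map (sa := P.setoidOb) (sb := P.setoidOb) (fun z => (z.1, z.2 * a))
    (fun _ _ ⟨g, h1, h2⟩ => ⟨g, h1, by simp [h2, mul_assoc]⟩) α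

/-- The right action on morphisms, `[x, k] f = [x, k f]`. -/
def assocActMor (α : P.AssocMor) (f : 𝔾.Mor) : P.AssocMor :=
  Quotient.map (sa := P.setoidMor) (sb := P.setoidMor) (fun z => (z.1, z.2 * f))
    (fun _ _ ⟨g, h1, h2⟩ => ⟨g, h1, by simp [h2, mul_assoc]⟩) α

/-- The right `𝔾` 2-space `P ×_G 𝔾` over `M`, with `[x, f] g = [x, f g]`. -/
def assoc : TwoSpaceOver.{max u v} 𝔾 M where
  toSmoothGroupoid := P.assocGroupoid
  proj := Quotient.lift (s := P.setoidOb) (fun z => P.proj z.1)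
    fun _ _ ⟨g, h1, _⟩ => by rw [h1, P.proj_act]
  proj_tgt := by rintro ⟨x, f⟩; rfl
  smooth_proj := dSmooth_quotient (P.smooth_proj.comp dSmooth_fst)
  actOb := P.assocActOb
  actMor := P.assocActMor
  actOb_one := by rintro ⟨x, a⟩; exact congrArg (P.mkOb x) (mul_one a)
  actOb_mul := by rintro ⟨x, a⟩ g h; exact congrArg (P.mkOb x) (mul_assoc a g h).symm
  actMor_one := by rintro ⟨x, a⟩; exact congrArg (P.mkMor x) (mul_one a)
  actMor_mul := by rintro ⟨x, a⟩ g h; exact congrArg (P.mkMor x) (mul_assoc a g h).symm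
  src_act := by rintro ⟨x, a⟩ g; exact congrArg (P.mkOb x) (𝔾.src_mul a g)
  tgt_act := by rintro ⟨x, a⟩ g; exact congrArg (P.mkOb x) (𝔾.tgt_mul a g)
  ident_act := by rintro ⟨x, a⟩ g; exact congrArg (P.mkMor x) (𝔾.ident_mul a g)
  comp_act α β g g' h h' := by
    obtain ⟨x, f, k, hfk, rfl, rfl⟩ := P.exists_rep α β h
    have h2 : 𝔾.src (f * g) = 𝔾.tgt (k * g') := by rw [𝔾.src_mul, 𝔾.tgt_mul, hfk, h']
    have e1 := P.assocComp_mk x f k hfk h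
    have e2 := P.assocComp_mk x (f * g) (k * g') h2 (congrArg (P.mkOb x) h2 :)
    refine e2.trans ?_
    rw [𝔾.comp_mul f k g g' hfk h']
    exact (congrArg (fun γ => P.assocActMor γ (𝔾.comp g g' h')) e1).symm
  proj_act := by rintro ⟨x, a⟩ g; rfl
  smooth_actOb n p hp z := by
    obtain ⟨U, hU, hz, H⟩ := hp.1 z
    refine ⟨U, hU, hz, fun m c hc hs => ?_⟩
    obtain ⟨q, hq, e⟩ := H m c hc hs
    refine ⟨fun y => ((q y).1, (q y).2 * (p (c y)).2), ⟨hq.1, 𝔾.smooth_mulOb m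
      (fun y => ((q y).2, (p (c y)).2)) ⟨hq.2, isPlot_reparam hp.2 hs⟩⟩, fun y => ?_⟩
    have := e y
    simp only [Function.comp] at this ⊢
    rw [this]
    rfl
  smooth_actMor n p hp z := by
    obtain ⟨U, hU, hz, H⟩ := hp.1 z
    refine ⟨U, hU, hz, fun m c hc hs => ?_⟩
    obtain ⟨q, hq, e⟩ := H m c hc hs
    refine ⟨fun y => ((q y).1, (q y).2 * (p (c y)).2), ⟨hq.1, 𝔾.smooth_mulMor m
      (fun y => ((q y).2, (p (c y)).2)) ⟨hq.2, isPlot_reparam hp.2 hs⟩⟩, fun y => ?_⟩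
    have := e y
    simp only [Function.comp] at this ⊢
    rw [this]
    rfl

end PrincipalSpace


/-! ### The Poincaré 2-group -/

section Poincare

variable (p q : ℕ)

/-- The vector space `ℝ^{p+q}`. -/
abbrev Rpq : Type := EuclideanSpace ℝ (Fin p ⊕ Fin q)

variable {p q}

/-- The standard bilinear form of signature `(p, q)`. -/
def eta (u v : Rpq p q) : ℝ :=
  ∑ i, u (Sum.inl i) * v (Sum.inl i) - ∑ j, u (Sum.inr j) * v (Sum.inr j)

theorem eta_comm (u v : Rpq p q) : eta u v = eta v u := by simp [eta, mul_comm]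

variable (p q)

/-- The group `O(p,q)` of linear isometries of `ℝ^{p,q}`. -/
def Lorentz : Subgroup (Rpq p q ≃L[ℝ] Rpq p q) where
  carrier := {k | ∀ u v, eta (k u) (k v) = eta u v}
  one_mem' := fun _ _ => rfl
  mul_mem' := fun {a b} ha hb u v => (ha (b u) (b v)).trans (hb u v)
  inv_mem' := fun {a} ha u v => by
    have := ha (a.symm u) (a.symm v)
    simp only [ContinuousLinearEquiv.apply_symm_apply] at this
    exact this.symm

/-- The Lie algebra `𝔬(p,q)`. -/
def lorentzAlgebra : Submodule ℝ (Rpq p q →L[ℝ] Rpq p q) where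
  carrier := {X | ∀ u v, eta (X u) v + eta u (X v) = 0}
  zero_mem' := fun u v => by simp [eta]
  add_mem' := fun {X Y} hX hY u v => by
    have h1 := hX u v
    have h2 := hY u v
    simp only [eta, add_apply, PiLp.add_apply, add_mul, mul_add,
      Finset.sum_add_distrib] at *
    linarith
  smul_mem' := fun c X hX u v => by
    have h1 := hX u v
    have h2 : eta ((c • X) u) v = c * eta (X u) v := by
      simp [eta, mul_sub, Finset.mul_sum, mul_assoc]
    have h3 : eta u ((c • X) v) = c * eta u (X v) := by
      simp [eta, mul_sub, Finset.mul_sum, mul_left_comm]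
    rw [h2, h3, ← mul_add, h1, mul_zero]

variable {p q}

/-- An element of `O(p,q)` as an endomorphism of `ℝ^{p,q}`. -/
def toEnd (k : Lorentz p q) : Rpq p q →L[ℝ] Rpq p q :=
  (k.1 : Rpq p q →L[ℝ] Rpq p q)

/-- `O(p,q)` has the smooth structure of a subspace of the vector space of endomorphisms. -/
instance instDiffLorentz : DiffeologicalSpace (Lorentz p q) :=
  letI := NormedSpace.toDiffeology (Rpq p q →L[ℝ] Rpq p q)
  inducedDiffeology fun _ : Unit => toEnd

theorem Lorentz.isPlot_iff {n : ℕ} {f : EuclideanSpace ℝ (Fin n) → Lorentz p q} :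
    IsPlot f ↔ ContDiff ℝ ∞ fun z => toEnd (f z) :=
  ⟨fun h => h (), fun h _ => h⟩

theorem Lorentz.smooth_mul : DSmooth fun z : Lorentz p q × Lorentz p q => z.1 * z.2 :=
  fun _ _ h => Lorentz.isPlot_iff.2
    ((Lorentz.isPlot_iff.1 h.1).clm_comp (Lorentz.isPlot_iff.1 h.2))

theorem Lorentz.smooth_inv : DSmooth fun k : Lorentz p q => k⁻¹ := fun n f h => by
  refine Lorentz.isPlot_iff.2 (contDiff_iff_contDiffAt.2 fun z => ?_)
  have h1 : (fun z => toEnd (((fun k : Lorentz p q => k⁻¹) ∘ f) z)) =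
      fun z => ContinuousLinearMap.inverse (toEnd (f z)) := by
    funext z
    exact (ContinuousLinearMap.inverse_equiv (f z).1).symm
  rw [h1]
  exact (contDiffAt_map_inverse (f z).1).comp z (Lorentz.isPlot_iff.1 h).contDiffAt

variable (p q) in
/-- The Poincaré group `IO(p,q)`. -/
@[ext]
structure Poincare where
  rot : Lorentz p q
  trans : Rpq p q

namespace Poincare

instance : Group (Poincare p q) where
  mul a b := ⟨a.rot * b.rot, a.trans + toEnd a.rot b.trans⟩
  one := ⟨1, 0⟩
  inv a := ⟨a.rot⁻¹, -(toEnd a.rot⁻¹ a.trans)⟩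
  mul_assoc a b c := by
    refine Poincare.ext (mul_assoc _ _ _) ?_
    change a.trans + toEnd a.rot b.trans + toEnd a.rot (toEnd b.rot c.trans) =
      a.trans + toEnd a.rot (b.trans + toEnd b.rot c.trans)
    rw [map_add, add_assoc]
  one_mul a := Poincare.ext (one_mul _) (zero_add _)
  mul_one a := Poincare.ext (mul_one _) (by
    change a.trans + toEnd a.rot 0 = a.trans
    simp)
  inv_mul_cancel a := Poincare.ext (inv_mul_cancel _) (neg_add_cancel _)

theorem mul_rot (a b : Poincare p q) : (a * b).rot = a.rot * b.rot := rfl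

theorem mul_trans (a b : Poincare p q) : (a * b).trans = a.trans + toEnd a.rot b.trans := rfl

instance : DiffeologicalSpace (Poincare p q) :=
  inducedDiffeology fun _ : Unit => fun a : Poincare p q => (a.rot, a.trans)

theorem isPlot_iff {n : ℕ} {f : EuclideanSpace ℝ (Fin n) → Poincare p q} :
    IsPlot f ↔ (IsPlot fun z => (f z).rot) ∧ IsPlot fun z => (f z).trans :=
  ⟨fun h => h (), fun h _ => h⟩

end Poincare

variable (p q)

/-- The Poincaré 2-group: the source and target of `(g, h)` are both `g`, and
`(g, h') ∘ (g, h) = (g, h' + h)`. -/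
def Poinc : Smooth2Group.{0} where
  Ob := Lorentz p q
  Mor := Poincare p q
  src := Poincare.rot
  tgt := Poincare.rot
  ident g := ⟨g, 0⟩
  inv a := ⟨a.rot, -a.trans⟩
  comp a b _ := ⟨a.rot, a.trans + b.trans⟩
  src_ident _ := rfl
  tgt_ident _ := rfl
  src_inv _ := rfl
  tgt_inv _ := rfl
  src_comp _ _ h := h
  tgt_comp _ _ _ := rfl
  ident_comp _ := Poincare.ext rfl (zero_add _)
  comp_ident _ := Poincare.ext rfl (add_zero _)
  inv_comp _ := Poincare.ext rfl (neg_add_cancel _)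
  comp_inv _ := Poincare.ext rfl (add_neg_cancel _)
  assoc _ _ _ _ _ := Poincare.ext rfl (add_assoc _ _ _)
  smooth_src _ _ h := (Poincare.isPlot_iff.1 h).1
  smooth_tgt _ _ h := (Poincare.isPlot_iff.1 h).1
  smooth_ident _ _ h := Poincare.isPlot_iff.2 ⟨h, isPlot_const⟩
  smooth_inv _ _ h := Poincare.isPlot_iff.2
    ⟨(Poincare.isPlot_iff.1 h).1, (Poincare.isPlot_iff.1 h).2.contDiff.neg.isPlot⟩
  smooth_comp _ _ h := Poincare.isPlot_iff.2
    ⟨(Poincare.isPlot_iff.1 (h ()).1).1, ((Poincare.isPlot_iff.1 (h ()).1).2.contDiff.add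
      (Poincare.isPlot_iff.1 (h ()).2).2.contDiff).isPlot⟩
  groupOb := inferInstance
  groupMor := inferInstance
  src_mul _ _ := rfl
  tgt_mul _ _ := rfl
  ident_mul a b := Poincare.ext rfl (by simp [Poincare.mul_trans])
  comp_mul f g f' g' h h' := Poincare.ext rfl (by
    simp only [Poincare.mul_trans, map_add, h]
    abel)
  smooth_mulOb := Lorentz.smooth_mul
  smooth_mulMor n f h := by
    have h1 := Poincare.isPlot_iff.1 h.1
    have h2 := Poincare.isPlot_iff.1 h.2
    have h3 := Lorentz.smooth_mul n (fun z => ((f z).1.rot, (f z).2.rot)) ⟨h1.1, h2.1⟩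
    exact Poincare.isPlot_iff.2 ⟨h3, (h1.2.contDiff.add
      ((Lorentz.isPlot_iff.1 h1.1).clm_apply h2.2.contDiff)).isPlot⟩
  smooth_invOb := Lorentz.smooth_inv
  smooth_invMor n f h := by
    have h1 := Poincare.isPlot_iff.1 h
    have h2 := Lorentz.smooth_inv _ _ h1.1
    exact Poincare.isPlot_iff.2 ⟨h2,
      ((Lorentz.isPlot_iff.1 h2).clm_apply h1.2.contDiff).neg.isPlot⟩

end Poincare

/-! ### Semi-Riemannian metrics and orthonormal frames -/

section Frames

variable (p q : ℕ) (E : Type v) [NormedAddCommGroup E] [NormedSpace ℝ E]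
  (M : Type w) [TopologicalSpace M] [ChartedSpace E M] [IsManifold 𝓘(ℝ, E) ∞ M]

/-- A smooth semi-Riemannian metric of signature `(p, q)`. -/
structure SemiRiemannianMetric where
  inner (x : M) : TangentSpace 𝓘(ℝ, E) x →L[ℝ] TangentSpace 𝓘(ℝ, E) x →L[ℝ] ℝ
  symm (x : M) (u v : TangentSpace 𝓘(ℝ, E) x) : inner x u v = inner x v u
  signature (x : M) : ∃ f : Rpq p q ≃L[ℝ] TangentSpace 𝓘(ℝ, E) x,
    ∀ u v, inner x (f u) (f v) = eta u v
  contMDiff : ContMDiff 𝓘(ℝ, E) (𝓘(ℝ, E).prod 𝓘(ℝ, E →L[ℝ] E →L[ℝ] ℝ)) ∞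
    (fun x ↦ TotalSpace.mk' (E →L[ℝ] E →L[ℝ] ℝ)
      (E := fun x : M => TangentSpace 𝓘(ℝ, E) x →L[ℝ] TangentSpace 𝓘(ℝ, E) x →L[ℝ] ℝ)
      x (inner x))

variable {p q E M}
variable (g : SemiRiemannianMetric p q E M)

/-- An orthonormal frame: a linear isometry from `ℝ^{p,q}` to a tangent space of `M`. -/
structure Frame where
  pt : M
  frame : Rpq p q ≃L[ℝ] TangentSpace 𝓘(ℝ, E) pt
  isometry : ∀ u v, g.inner pt (frame u) (frame v) = eta u v

namespace Frame

variable {g}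

/-- The value of a frame at a vector of `ℝ^{p,q}`. -/
def eval (w : Rpq p q) (φ : Frame g) : TangentBundle 𝓘(ℝ, E) M := ⟨φ.pt, φ.frame w⟩

/-- A family of frames is smooth if all the vectors of the frames depend smoothly on it. -/
instance instDiffFrame : DiffeologicalSpace (Frame g) :=
  letI := manifoldDiffeology 𝓘(ℝ, E).tangent (TangentBundle 𝓘(ℝ, E) M)
  inducedDiffeology (eval (g := g))

theorem isPlot_iff {n : ℕ} {f : EuclideanSpace ℝ (Fin n) → Frame g} : IsPlot f ↔
    ∀ w, ContMDiff 𝓘(ℝ, EuclideanSpace ℝ (Fin n)) 𝓘(ℝ, E).tangent ∞ fun z => eval w (f z) :=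
  Iff.rfl

/-- The right action of `O(p,q)`. -/
def act (φ : Frame g) (k : Lorentz p q) : Frame g where
  pt := φ.pt
  frame := k.1.trans φ.frame
  isometry u v := (φ.isometry _ _).trans (k.2 u v)

/-- The frame of `φ` regarded at a point `x` equal to its base point. -/
def frameAt (φ : Frame g) (x : M) (h : φ.pt = x) : Rpq p q ≃L[ℝ] TangentSpace 𝓘(ℝ, E) x :=
  h ▸ φ.frame

theorem frameAt_isometry (φ : Frame g) (x : M) (h : φ.pt = x) (u v : Rpq p q) :
    g.inner x (φ.frameAt x h u) (φ.frameAt x h v) = eta u v := by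
  subst h; exact φ.isometry u v

theorem eval_frameAt (φ : Frame g) (x : M) (h : φ.pt = x) (w : Rpq p q) :
    eval w φ = ⟨x, φ.frameAt x h w⟩ := by
  subst h; rfl

theorem ext_frameAt {φ ψ : Frame g} (h : ψ.pt = φ.pt) (h' : ∀ w, φ.frame w = ψ.frameAt φ.pt h w) :
    φ = ψ := by
  obtain ⟨x, f, hf⟩ := φ
  obtain ⟨y, f', hf'⟩ := ψ
  simp only at h
  subst h
  have : f = f' := ContinuousLinearEquiv.ext (funext h')
  subst this
  rfl

/-- The element of `O(p,q)` relating two frames at the same point. -/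
def div (φ ψ : Frame g) (h : φ.pt = ψ.pt) : Lorentz p q :=
  ⟨(ψ.frameAt φ.pt h.symm).trans φ.frame.symm, fun u v => by
    rw [← φ.isometry]
    simpa using ψ.frameAt_isometry φ.pt h.symm u v⟩

theorem frame_div (φ ψ : Frame g) (h : φ.pt = ψ.pt) (w : Rpq p q) :
    φ.frame (toEnd (φ.div ψ h) w) = ψ.frameAt φ.pt h.symm w := by
  simp [div, toEnd]

theorem act_div (φ ψ : Frame g) (h : φ.pt = ψ.pt) : φ.act (φ.div ψ h) = ψ :=
  ext_frameAt h.symm fun w => φ.frame_div ψ h w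

theorem eta_single_inl (u : Rpq p q) (i : Fin p) :
    eta u (EuclideanSpace.single (Sum.inl i) 1) = u (Sum.inl i) := by
  simp [eta]

theorem eta_single_inr (u : Rpq p q) (j : Fin q) :
    eta u (EuclideanSpace.single (Sum.inr j) 1) = -u (Sum.inr j) := by
  simp [eta]

/-- Finite linear combinations of smooth families of tangent vectors are smooth. -/
theorem contMDiff_sum {n : ℕ} {ι : Type*} (s : Finset ι) {b : EuclideanSpace ℝ (Fin n) → M}
    {V : ι → (z : EuclideanSpace ℝ (Fin n)) → TangentSpace 𝓘(ℝ, E) (b z)}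
    {c : ι → EuclideanSpace ℝ (Fin n) → ℝ}
    (hb : ContMDiff 𝓘(ℝ, EuclideanSpace ℝ (Fin n)) 𝓘(ℝ, E) ∞ b)
    (hV : ∀ i, ContMDiff 𝓘(ℝ, EuclideanSpace ℝ (Fin n)) 𝓘(ℝ, E).tangent ∞
      fun z => (⟨b z, V i z⟩ : TangentBundle 𝓘(ℝ, E) M))
    (hc : ∀ i, ContDiff ℝ ∞ (c i)) :
    ContMDiff 𝓘(ℝ, EuclideanSpace ℝ (Fin n)) 𝓘(ℝ, E).tangent ∞
      fun z => (⟨b z, ∑ i ∈ s, c i z • V i z⟩ : TangentBundle 𝓘(ℝ, E) M) := by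
  intro z
  refine (Bundle.contMDiffAt_totalSpace (f := fun z =>
    (⟨b z, ∑ i ∈ s, c i z • V i z⟩ : TangentBundle 𝓘(ℝ, E) M))).2 ⟨hb z, ?_⟩
  have h1 : ∀ i, ContMDiffAt 𝓘(ℝ, EuclideanSpace ℝ (Fin n)) 𝓘(ℝ, E) ∞
      (fun z' => (trivializationAt E (TangentSpace 𝓘(ℝ, E)) (b z) ⟨b z', V i z'⟩).2) z :=
    fun i => ((Bundle.contMDiffAt_totalSpace (f := fun z =>
      (⟨b z, V i z⟩ : TangentBundle 𝓘(ℝ, E) M))).1 (hV i z)).2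
  have h2 : ContMDiffAt 𝓘(ℝ, EuclideanSpace ℝ (Fin n)) 𝓘(ℝ, E) ∞ (fun z' => ∑ i ∈ s,
      c i z' • (trivializationAt E (TangentSpace 𝓘(ℝ, E)) (b z) ⟨b z', V i z'⟩).2) z :=
    ContMDiffAt.sum fun i _ => (hc i).contMDiff.contMDiffAt.smul (h1 i)
  refine h2.congr_of_eventuallyEq ?_
  have h3 : b ⁻¹' (trivializationAt E (TangentSpace 𝓘(ℝ, E)) (b z)).baseSet ∈ nhds z :=
    (hb.continuous.continuousAt).preimage_mem_nhds
      ((trivializationAt E (TangentSpace 𝓘(ℝ, E)) (b z)).open_baseSet.mem_nhds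
        (FiberBundle.mem_baseSet_trivializationAt' (b z)))
  filter_upwards [h3] with z' hz'
  have hl := Trivialization.coe_linearMapAt_of_mem (R := ℝ)
    (trivializationAt E (TangentSpace 𝓘(ℝ, E) (M := M)) (b z)) hz'
  have h4 := map_sum ((trivializationAt E (TangentSpace 𝓘(ℝ, E) (M := M)) (b z)).linearMapAt ℝ
    (b z')) (fun i => c i z' • V i z') s
  simp only [map_smul, hl] at h4
  exact h4

theorem contMDiff_pt {n : ℕ} {f : EuclideanSpace ℝ (Fin n) → Frame g} (h : IsPlot f) :
    ContMDiff 𝓘(ℝ, EuclideanSpace ℝ (Fin n)) 𝓘(ℝ, E) ∞ fun z => (f z).pt :=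
  (Bundle.contMDiff_proj (TangentSpace 𝓘(ℝ, E))).comp (isPlot_iff.1 h 0)

theorem smooth_act {n : ℕ} {f : EuclideanSpace ℝ (Fin n) → Frame g × Lorentz p q}
    (h : IsPlot f) : IsPlot fun z => (f z).1.act (f z).2 := by
  refine isPlot_iff.2 fun w => ?_
  have h2 := Lorentz.isPlot_iff.1 h.2
  have key := contMDiff_sum (Finset.univ : Finset (Fin p ⊕ Fin q))
    (V := fun a z => (f z).1.frame (EuclideanSpace.single a 1))
    (c := fun a z => toEnd (f z).2 w a)
    (contMDiff_pt h.1) (fun a => isPlot_iff.1 h.1 (EuclideanSpace.single a 1))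
    (fun a => (contDiff_euclidean.1 (h2.clm_apply contDiff_const)) a)
  refine key.congr fun z => ?_
  refine congrArg (TotalSpace.mk' E (f z).1.pt) ?_
  change (f z).1.frame (toEnd (f z).2 w) = _
  have hw : toEnd (f z).2 w = ∑ a, toEnd (f z).2 w a • EuclideanSpace.single a (1 : ℝ) := by
    simpa using ((EuclideanSpace.basisFun _ ℝ).sum_repr (toEnd (f z).2 w)).symm
  conv_lhs => rw [hw, map_sum]
  exact Finset.sum_congr rfl fun a _ => map_smul _ _ _

theorem smooth_div {n : ℕ}
    {f : EuclideanSpace ℝ (Fin n) → {z : Frame g × Frame g // z.1.pt = z.2.pt}}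
    (h : IsPlot f) : IsPlot fun z => (f z).1.1.div (f z).1.2 (f z).2 := by
  refine Lorentz.isPlot_iff.2 (contDiff_clm_apply_iff.2 fun w => contDiff_euclidean.2 fun a => ?_)
  have h1 : ∀ u, ContDiff ℝ ∞ fun z => eta (toEnd ((f z).1.1.div (f z).1.2 (f z).2) w) u := by
    intro u
    have e : (fun z => eta (toEnd ((f z).1.1.div (f z).1.2 (f z).2) w) u) = fun z =>
        g.inner (f z).1.1.pt ((f z).1.2.frameAt _ (f z).2.symm w) ((f z).1.1.frame u) := by
      funext z
      rw [← frame_div, (f z).1.1.isometry]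
    rw [e]
    have hb := contMDiff_pt (h ()).1
    have hv := isPlot_iff.1 (h ()).1 u
    have hw : ContMDiff 𝓘(ℝ, EuclideanSpace ℝ (Fin n)) 𝓘(ℝ, E).tangent ∞
        fun z => (⟨(f z).1.1.pt, (f z).1.2.frameAt _ (f z).2.symm w⟩ : TangentBundle 𝓘(ℝ, E) M) := by
      refine (isPlot_iff.1 (h ()).2 w).congr fun z => ?_
      exact ((f z).1.2.eval_frameAt _ (f z).2.symm w).symm
    refine ContMDiff.contDiff fun z => ?_
    have hg := (g.contMDiff.comp hb) z
    have := ContMDiffAt.clm_bundle_apply₂ (F₁ := E) (F₂ := E)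
      (E₃ := Bundle.Trivial M ℝ) hg (hw z) (hv z)
    simp only [contMDiffAt_totalSpace] at this
    exact this.2
  rcases a with i | j
  · have h2 := h1 (EuclideanSpace.single (Sum.inl i) 1)
    simpa only [eta_single_inl] using h2
  · have h2 := (h1 (EuclideanSpace.single (Sum.inr j) 1)).neg
    simpa only [eta_single_inr, neg_neg] using h2

end Frame

/-- The bundle `FM` of orthonormal frames, a principal `O(p,q)` bundle. -/
def frameBundle : @PrincipalSpace (Poinc p q).Ob _ _ M (manifoldDiffeology 𝓘(ℝ, E) M) :=
  letI := manifoldDiffeology 𝓘(ℝ, E) M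
  { P := Frame g
    proj := Frame.pt
    act := Frame.act
    div := Frame.div
    act_one := fun _ => rfl
    act_mul := fun _ _ _ => rfl
    proj_act := fun _ _ => rfl
    act_div := Frame.act_div
    free := fun φ k l h => by
      refine Subtype.ext (ContinuousLinearEquiv.ext (funext fun w => ?_))
      have h1 : Frame.eval w (φ.act k) = Frame.eval w (φ.act l) := by rw [h]
      exact φ.frame.injective (TotalSpace.mk_injective _ h1)
    smooth_proj := fun _ _ h => Frame.contMDiff_pt h
    smooth_act := fun _ _ h => Frame.smooth_act h
    smooth_div := fun _ _ h => Frame.smooth_div h }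

/-- The 2-frame 2-bundle `FM ×_{O(p,q)} Poinc(p,q)`. -/
def twoFrame : @TwoSpaceOver (Poinc p q) M (manifoldDiffeology 𝓘(ℝ, E) M) :=
  letI := manifoldDiffeology 𝓘(ℝ, E) M
  (frameBundle g).assoc

/-- The identification of the objects of the 2-frame 2-bundle with orthonormal frames:
`[φ, k]` corresponds to `φ k`. -/
def toFrame : (twoFrame g).Ob → Frame g :=
  letI := manifoldDiffeology 𝓘(ℝ, E) M
  Quotient.lift (s := (frameBundle g).setoidOb) (fun z => z.1.act z.2) (by
    rintro ⟨φ, a⟩ ⟨ψ, b⟩ ⟨k, h1, h2⟩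
    simp only at h1 h2
    subst h1 h2
    exact (frameBundle g).act_mul φ k b)

theorem toFrame_pt (a : (twoFrame g).Ob) : (toFrame g a).pt =
    @TwoSpaceOver.proj _ _ (manifoldDiffeology 𝓘(ℝ, E) M) (twoFrame g) a := by
  obtain ⟨⟨φ, k⟩, rfl⟩ := Quotient.exists_rep a
  rfl

end Frames

/-! ### 2-connections -/

section TwoConnections

/-- In the crossed module of the Poincaré 2-group, `H = ℝ^{p,q}` is the group of morphisms
`(1, h)` with source `1`. -/
def hInc {p q : ℕ} (h : Rpq p q) : (Poinc p q).Mor := (⟨1, h⟩ : Poincare p q)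

/-- The action `α` of `O(p,q)` on `H`. -/
def alpha {p q : ℕ} (k : (Poinc p q).Ob) : Rpq p q →L[ℝ] Rpq p q := toEnd k

/-- `α` is given by conjugation with identity morphisms. -/
theorem hInc_alpha {p q : ℕ} (k : Lorentz p q) (h : Rpq p q) :
    hInc (alpha k h) = (Poinc p q).ident k * hInc h * ((Poinc p q).ident k)⁻¹ := by
  refine Poincare.ext ?_ ?_
  · change 1 = k * 1 * k⁻¹
    simp
  · change toEnd k h = 0 + toEnd k h + toEnd (k * 1) (-(toEnd k⁻¹ 0))
    simp

/-- The homomorphism `t : H → O(p,q)`, `t (h) = target (1, h)`, is trivial. -/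
theorem tgt_hInc {p q : ℕ} (h : Rpq p q) : (Poinc p q).tgt (hInc h) = 1 := rfl

/-- The differential `ℝ^{p,q} → 𝔬(p,q)` of `t`. -/
def tLie {p q : ℕ} : Rpq p q →L[ℝ] (Rpq p q →L[ℝ] Rpq p q) := 0

theorem hasFDerivAt_tgt_hInc {p q : ℕ} (h : Rpq p q) :
    HasFDerivAt (fun h : Rpq p q => toEnd ((Poinc p q).tgt (hInc h))) tLie h := by
  change HasFDerivAt (fun _ : Rpq p q => toEnd (1 : Lorentz p q)) 0 h
  exact hasFDerivAt_const _ _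

/-- The differential of `α`, the representation of `𝔬(p,q)` on `ℝ^{p,q}`. -/
def alphaLie {p q : ℕ} : (Rpq p q →L[ℝ] Rpq p q) →L[ℝ] (Rpq p q →L[ℝ] Rpq p q) :=
  ContinuousLinearMap.id ℝ _

variable {p q : ℕ} {E : Type v} [NormedAddCommGroup E] [NormedSpace ℝ E]
  {M : Type w} [TopologicalSpace M] [ChartedSpace E M] [IsManifold 𝓘(ℝ, E) ∞ M]

/-- A smooth vector field on `M`. -/
def SmoothField (X : (x : M) → TangentSpace 𝓘(ℝ, E) x) : Prop :=
  ContMDiff 𝓘(ℝ, E) 𝓘(ℝ, E).tangent ∞ fun x => (⟨x, X x⟩ : TangentBundle 𝓘(ℝ, E) M)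

/-- `d A + A ∧ A` for an endomorphism-valued 1-form `A`, evaluated on vector fields:
`X (A Y) - Y (A X) - A [X, Y] + [A X, A Y]`. -/
def curvatureForm (A : (x : M) → TangentSpace 𝓘(ℝ, E) x →L[ℝ] (Rpq p q →L[ℝ] Rpq p q))
    (X Y : (x : M) → TangentSpace 𝓘(ℝ, E) x) (x : M) : Rpq p q →L[ℝ] Rpq p q :=
  mvfderiv 𝓘(ℝ, E) (fun y => A y (Y y)) x (X x) - mvfderiv 𝓘(ℝ, E) (fun y => A y (X y)) x (Y x)
    - A x (VectorField.mlieBracket 𝓘(ℝ, E) X Y x)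
    + (A x (X x) ∘L A x (Y x) - A x (Y x) ∘L A x (X x))

/-- The exterior derivative of a vector-valued 2-form `B`, evaluated on vector fields. -/
def extDerivTwoForm
    (B : (x : M) → TangentSpace 𝓘(ℝ, E) x →L[ℝ] TangentSpace 𝓘(ℝ, E) x →L[ℝ] Rpq p q)
    (X Y Z : (x : M) → TangentSpace 𝓘(ℝ, E) x) (x : M) : Rpq p q :=
  mvfderiv 𝓘(ℝ, E) (fun y => B y (Y y) (Z y)) x (X x)
    - mvfderiv 𝓘(ℝ, E) (fun y => B y (X y) (Z y)) x (Y x)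
    + mvfderiv 𝓘(ℝ, E) (fun y => B y (X y) (Y y)) x (Z x)
    - B x (VectorField.mlieBracket 𝓘(ℝ, E) X Y x) (Z x)
    + B x (VectorField.mlieBracket 𝓘(ℝ, E) X Z x) (Y x)
    - B x (VectorField.mlieBracket 𝓘(ℝ, E) Y Z x) (X x)

/-- The 2-curvature `d B + α(A) ∧ B`, evaluated on vector fields. -/
def twoCurvatureForm (A : (x : M) → TangentSpace 𝓘(ℝ, E) x →L[ℝ] (Rpq p q →L[ℝ] Rpq p q))
    (B : (x : M) → TangentSpace 𝓘(ℝ, E) x →L[ℝ] TangentSpace 𝓘(ℝ, E) x →L[ℝ] Rpq p q)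
    (X Y Z : (x : M) → TangentSpace 𝓘(ℝ, E) x) (x : M) : Rpq p q :=
  extDerivTwoForm B X Y Z x
    + (alphaLie (A x (X x)) (B x (Y x) (Z x)) - alphaLie (A x (Y x)) (B x (X x) (Z x))
      + alphaLie (A x (Z x)) (B x (X x) (Y x)))

variable (E) in
/-- Local data for a 2-connection on a 2-bundle `P` over `M` with the Poincaré 2-group: for each
local trivialization a 1-form `A` and a 2-form `B`. Only their values over the domain of the
trivialization matter. -/
structure LocalForms [DiffeologicalSpace M] (P : TwoSpaceOver (Poinc p q) M) where
  A : LocalTriv P → (x : M) → TangentSpace 𝓘(ℝ, E) x →L[ℝ] (Rpq p q →L[ℝ] Rpq p q)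
  B : LocalTriv P → (x : M) → TangentSpace 𝓘(ℝ, E) x →L[ℝ] TangentSpace 𝓘(ℝ, E) x →L[ℝ] Rpq p q

/-- `c` is a strict 2-connection on the principal 2-bundle `P`: the forms `A` and `B` are smooth
with values in `𝔬(p,q)` and `ℝ^{p,q}`, they satisfy the fake flatness condition, and on overlaps
they are related by the gauge transformations given by the transition functions. -/
structure IsStrict2Connection [DiffeologicalSpace M] (P : TwoSpaceOver (Poinc p q) M)
    (c : LocalForms E P) : Prop where
  isPrincipal : P.IsPrincipal2Bundle
  A_mem : ∀ t : LocalTriv P, ∀ x ∈ t.U, ∀ v, c.A t x v ∈ lorentzAlgebra p q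
  B_alt : ∀ t : LocalTriv P, ∀ x ∈ t.U, ∀ v, c.B t x v v = 0
  smooth_A : ∀ (t : LocalTriv P) (X : (x : M) → TangentSpace 𝓘(ℝ, E) x), SmoothField X →
    ContMDiffOn 𝓘(ℝ, E) 𝓘(ℝ, Rpq p q →L[ℝ] Rpq p q) ∞ (fun x => c.A t x (X x)) t.U
  smooth_B : ∀ (t : LocalTriv P) (X Y : (x : M) → TangentSpace 𝓘(ℝ, E) x), SmoothField X →
    SmoothField Y → ContMDiffOn 𝓘(ℝ, E) 𝓘(ℝ, Rpq p q) ∞ (fun x => c.B t x (X x) (Y x)) t.U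
  fake_flat : ∀ (t : LocalTriv P) (X Y : (x : M) → TangentSpace 𝓘(ℝ, E) x), SmoothField X →
    SmoothField Y → ∀ x ∈ t.U, curvatureForm (c.A t) X Y x = tLie (c.B t x (X x) (Y x))
  gauge_A : ∀ (t t' : LocalTriv P), ∀ x ∈ t.U ∩ t'.U, ∀ v : TangentSpace 𝓘(ℝ, E) x,
    c.A t x v = toEnd (t.transition t' x) ∘L c.A t' x v ∘L toEnd (t.transition t' x)⁻¹
      + toEnd (t.transition t' x) ∘L
        mvfderiv 𝓘(ℝ, E) (fun y => toEnd (t.transition t' y)⁻¹) x v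
  gauge_B : ∀ (t t' : LocalTriv P), ∀ x ∈ t.U ∩ t'.U, ∀ v w : TangentSpace 𝓘(ℝ, E) x,
    c.B t x v w = alpha (t.transition t' x) (c.B t' x v w)

/-- The curvature and the 2-curvature vanish. -/
def LocalForms.IsFlat [DiffeologicalSpace M] {P : TwoSpaceOver (Poinc p q) M}
    (c : LocalForms E P) : Prop :=
  (∀ (t : LocalTriv P) (X Y : (x : M) → TangentSpace 𝓘(ℝ, E) x), SmoothField X → SmoothField Y →
    ∀ x ∈ t.U, curvatureForm (c.A t) X Y x = 0) ∧
  (∀ (t : LocalTriv P) (X Y Z : (x : M) → TangentSpace 𝓘(ℝ, E) x), SmoothField X →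
    SmoothField Y → SmoothField Z → ∀ x ∈ t.U, twoCurvatureForm (c.A t) (c.B t) X Y Z x = 0)

/-! ### Flat metric-compatible connections -/

/-- The curvature of a connection on the tangent bundle vanishes. -/
def IsFlatConnection
    (D : CovariantDerivative 𝓘(ℝ, E) E (TangentSpace 𝓘(ℝ, E) : M → Type _)) : Prop :=
  ∀ X Y Z : (x : M) → TangentSpace 𝓘(ℝ, E) x, SmoothField X → SmoothField Y → SmoothField Z →
    ∀ x, D (fun y => D Z y (Y y)) x (X x) - D (fun y => D Z y (X y)) x (Y x)
      - D Z x (VectorField.mlieBracket 𝓘(ℝ, E) X Y x) = 0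

/-- `X (g (Y, Z)) = g (D_X Y, Z) + g (Y, D_X Z)`. -/
def IsMetricCompatible (g : SemiRiemannianMetric p q E M)
    (D : CovariantDerivative 𝓘(ℝ, E) E (TangentSpace 𝓘(ℝ, E) : M → Type _)) : Prop :=
  ∀ X Y Z : (x : M) → TangentSpace 𝓘(ℝ, E) x, SmoothField X → SmoothField Y → SmoothField Z →
    ∀ x, mvfderiv 𝓘(ℝ, E) (fun y => g.inner y (Y y) (Z y)) x (X x) =
      g.inner x (D Y x (X x)) (Z x) + g.inner x (Y x) (D Z x (X x))

/-! ### The local forms of a connection and a tangent-bundle-valued 2-form -/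

section LocalFormsOf

variable (g : SemiRiemannianMetric p q E M)

/-- The orthonormal frame at `x` that a local trivialization `t` of the 2-frame 2-bundle
assigns to `x`, namely the object `t⁻¹(x, 1)`. It is `0` outside the domain of `t`. -/
def localFrame (t : @LocalTriv (Poinc p q) M _ (manifoldDiffeology 𝓘(ℝ, E) M) (twoFrame g))
    (x : M) : Rpq p q →L[ℝ] TangentSpace 𝓘(ℝ, E) x :=
  letI := manifoldDiffeology 𝓘(ℝ, E) M
  open Classical in
  if h : x ∈ t.U then
    ((toFrame g (t.sect x h)).frameAt x ((toFrame_pt g _).trans (t.proj_sect x h)) :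
      Rpq p q →L[ℝ] TangentSpace 𝓘(ℝ, E) x)
  else 0

/-- The pair `(D, T)` of a connection `D` and a `TM`-valued 2-form `T` in local trivializations
of the 2-frame 2-bundle. If `s` is the local frame of `t` with vectors `s_a`, then `A` is the
connection matrix, `A(v) e_a = s⁻¹ (D_v s_a)`, and `B(v, w) = s⁻¹ (T(v, w))`. -/
def localFormsOf (D : CovariantDerivative 𝓘(ℝ, E) E (TangentSpace 𝓘(ℝ, E) : M → Type _))
    (T : (x : M) → TangentSpace 𝓘(ℝ, E) x →L[ℝ] TangentSpace 𝓘(ℝ, E) x →L[ℝ]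
      TangentSpace 𝓘(ℝ, E) x) :
    @LocalForms p q E _ _ M _ _ (manifoldDiffeology 𝓘(ℝ, E) M) (twoFrame g) :=
  letI := manifoldDiffeology 𝓘(ℝ, E) M
  { A := fun t x => ∑ a, ContinuousLinearMap.smulRightL ℝ (Rpq p q) (Rpq p q)
      (EuclideanSpace.proj a) ∘L ContinuousLinearMap.inverse (localFrame g t x) ∘L
        D (fun y => localFrame g t y (EuclideanSpace.single a 1)) x
    B := fun t x => ContinuousLinearMap.postcomp (TangentSpace 𝓘(ℝ, E) x)
      (ContinuousLinearMap.inverse (localFrame g t x)) ∘L T x }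

end LocalFormsOf

end TwoConnections

end HigherGauge

end

open HigherGauge

/-!
A local trivialization of the 2-frame 2-bundle is the same thing as a smooth local orthonormal
frame, and in such a frame the claims are the classical identities of Cartan's moving frames.

*From frames to trivializations.* A smooth section `σ` of the frame bundle over `U` gives the
isomorphism `(x, k) ↦ [σ(x), k]` of `U × Poinc(p,q)` with the part of the 2-bundle over `U`
(`PrincipalSpace.localTrivOfSection`). Orthonormal frames exist near every point
(`exists_isOrthonormalFrameOn`): take a smooth frame `φ` that is orthonormal at the point, let `H`
be the `η`-self-adjoint operator with `g(φ u, φ v) = η(H u, v)`, and pass to `φ R⁻¹` with `R` the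
`η`-self-adjoint square root of `H` near `1`, which depends smoothly on `H` by the inverse function
theorem. This replaces the Gram–Schmidt process and works in every signature.

*From trivializations to frames.* The inverse of a local trivialization `t` is smooth, so that the
frame `x ↦ t⁻¹(x, 1)` takes plots to plots. On a finite-dimensional manifold this implies that it is
smooth (`FrameTriv.isOrthonormalFrameOn`), and two such frames differ by the transition function
(`FrameTriv.localFrame_transition`).

*Calculus in a frame.* For a frame `s` with connection form `A`, the Leibniz rule reads
`D_v (s f) = s (df(v) + A(v) f)` (`IsOrthonormalFrameOn.covariantDerivative_apply`). Written in
two frames it gives the gauge transformation of `A`. Applied twice, it identifies `dA + A ∧ A` with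
the curvature of `D`, which is zero; since the target homomorphism is trivial this is also the fake
flatness condition. Metric compatibility makes `A` take values in `𝔬(p,q)`. With `B = s⁻¹ T`,
the form `dB + A ∧ B` is `s⁻¹` applied to the exterior covariant derivative of the torsion,
which vanishes by the first Bianchi identity because `D` is flat (`bianchi_of_isFlatConnection`).
Flatness and compatibility speak of global vector fields only; bump functions extend the local
frame fields to global ones near a given point.
-/

open scoped Topology

noncomputable section

namespace HigherGauge

/-! ### Smooth fields and covariant derivatives -/

section Fields

variable {E : Type*} [NormedAddCommGroup E] [NormedSpace ℝ E]
  {M : Type*} [TopologicalSpace M] [ChartedSpace E M] [IsManifold 𝓘(ℝ, E) ∞ M]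

/-- A vector field on `M` that is smooth on a set `U`; nothing is asked outside `U`. -/
def SmoothFieldOn (V : (x : M) → TangentSpace 𝓘(ℝ, E) x) (U : Set M) : Prop :=
  ContMDiffOn 𝓘(ℝ, E) 𝓘(ℝ, E).tangent ∞ (fun x => (⟨x, V x⟩ : TangentBundle 𝓘(ℝ, E) M)) U

variable {V W : (x : M) → TangentSpace 𝓘(ℝ, E) x} {U : Set M}

theorem SmoothField.smoothFieldOn (h : SmoothField V) : SmoothFieldOn V U :=
  ContMDiff.contMDiffOn h

theorem SmoothFieldOn.mono {U' : Set M} (h : SmoothFieldOn V U) (hU : U' ⊆ U) :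
    SmoothFieldOn V U' :=
  ContMDiffOn.mono h hU

theorem SmoothFieldOn.congr (h : SmoothFieldOn V U) (hVW : ∀ x ∈ U, W x = V x) :
    SmoothFieldOn W U :=
  ContMDiffOn.congr h fun x hx => by rw [hVW x hx]

theorem SmoothFieldOn.contMDiffAt (h : SmoothFieldOn V U) (hU : IsOpen U) {x : M} (hx : x ∈ U) :
    ContMDiffAt 𝓘(ℝ, E) 𝓘(ℝ, E).tangent ∞
      (fun x => (⟨x, V x⟩ : TangentBundle 𝓘(ℝ, E) M)) x :=
  ContMDiffOn.contMDiffAt h (hU.mem_nhds hx)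

theorem SmoothFieldOn.mdifferentiableAt (h : SmoothFieldOn V U) (hU : IsOpen U) {x : M}
    (hx : x ∈ U) : MDifferentiableAt 𝓘(ℝ, E) 𝓘(ℝ, E).tangent
      (fun x => (⟨x, V x⟩ : TangentBundle 𝓘(ℝ, E) M)) x :=
  (h.contMDiffAt hU hx).mdifferentiableAt (by simp)

theorem SmoothField.mdifferentiableAt (h : SmoothField V) (x : M) :
    MDifferentiableAt 𝓘(ℝ, E) 𝓘(ℝ, E).tangent
      (fun x => (⟨x, V x⟩ : TangentBundle 𝓘(ℝ, E) M)) x :=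
  (h.contMDiffAt (x := x)).mdifferentiableAt (by simp)

theorem SmoothField.sub (hV : SmoothField V) (hW : SmoothField W) :
    SmoothField fun x => V x - W x := fun x =>
  ContMDiffAt.sub_section (hV x) (hW x)

theorem SmoothFieldOn.smul {f : M → ℝ} (hf : ContMDiffOn 𝓘(ℝ, E) 𝓘(ℝ) ∞ f U)
    (hV : SmoothFieldOn V U) : SmoothFieldOn (fun x => f x • V x) U :=
  ContMDiffOn.smul_section hf hV

theorem SmoothFieldOn.sum {ι : Type*} {s : Finset ι} {V : ι → (x : M) → TangentSpace 𝓘(ℝ, E) x}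
    (hV : ∀ i ∈ s, SmoothFieldOn (V i) U) : SmoothFieldOn (fun x => ∑ i ∈ s, V i x) U :=
  ContMDiffOn.sum_section hV

theorem SmoothField.mlieBracket [CompleteSpace E] (hV : SmoothField V) (hW : SmoothField W) :
    SmoothField (VectorField.mlieBracket 𝓘(ℝ, E) V W) := by
  have h2 : IsManifold 𝓘(ℝ, E) (minSmoothness ℝ 2) M :=
    IsManifold.of_le (n := ∞) (by simpa using ENat.LEInfty.out)
  have h3 : IsManifold 𝓘(ℝ, E) ((⊤ : ℕ∞) + 1) M :=
    IsManifold.of_le (n := ∞) le_rfl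
  refine ContDiff.mlieBracket_vectorField (m := ⊤) (n := ⊤) hV hW ?_
  simp

variable [FiniteDimensional ℝ E] [T2Space M]

/-- Near a point of an open set `U`, a vector field that is smooth on `U` agrees with a globally
smooth one, its product with a bump function. -/
theorem SmoothFieldOn.exists_smoothField (hU : IsOpen U) (hV : SmoothFieldOn V U) {x : M}
    (hx : x ∈ U) : ∃ W : (x : M) → TangentSpace 𝓘(ℝ, E) x, SmoothField W ∧ W =ᶠ[𝓝 x] V := by
  obtain ⟨f, hf, -⟩ := (SmoothBumpFunction.nhds_basis_support (I := 𝓘(ℝ, E))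
    (hU.mem_nhds hx)).mem_iff.1 (hU.mem_nhds hx)
  refine ⟨fun y => f y • V y, fun y => ?_, ?_⟩
  · -- The product is smooth on `U` and vanishes off the closed support of `f`, which is in `U`.
    by_cases hy : y ∈ tsupport f
    · exact ContMDiffAt.smul_section (f.contMDiff y) (hV.contMDiffAt hU (hf hy))
    · have h0 : ContMDiffAt 𝓘(ℝ, E) 𝓘(ℝ, E).tangent ∞
          (fun x => (⟨x, 0⟩ : TangentBundle 𝓘(ℝ, E) M)) y :=
        (contMDiff_zeroSection ℝ (TangentSpace 𝓘(ℝ, E) (M := M))) y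
      refine h0.congr_of_eventuallyEq ?_
      filter_upwards [(isClosed_tsupport f).isOpen_compl.mem_nhds hy] with z hz
      rw [image_eq_zero_of_notMem_tsupport hz, zero_smul]
  · filter_upwards [f.eventuallyEq_one] with y hy
    rw [hy, Pi.one_apply, one_smul]

theorem exists_smoothField_apply_eq (x : M) (v : TangentSpace 𝓘(ℝ, E) x) :
    ∃ X : (x : M) → TangentSpace 𝓘(ℝ, E) x, SmoothField X ∧ X x = v := by
  obtain ⟨s, hs, h⟩ := FiberBundle.exists_contMDiffOn_extend (k := ∞) 𝓘(ℝ, E) E v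
  obtain ⟨W, hW, e⟩ := SmoothFieldOn.exists_smoothField isOpen_interior
    (SmoothFieldOn.mono h interior_subset) (mem_interior_iff_mem_nhds.2 hs)
  exact ⟨W, hW, by rw [e.self_of_nhds, FiberBundle.extend_apply_self]⟩

end Fields

section Connections

variable {E : Type*} [NormedAddCommGroup E] [NormedSpace ℝ E]
  {M : Type*} [TopologicalSpace M] [ChartedSpace E M] [IsManifold 𝓘(ℝ, E) ∞ M]
  {V W X : (x : M) → TangentSpace 𝓘(ℝ, E) x} {U : Set M}
  (D : CovariantDerivative 𝓘(ℝ, E) E (TangentSpace 𝓘(ℝ, E) : M → Type _))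

/-- A covariant derivative is local in the field that is differentiated. -/
theorem covariantDerivative_congr {x : M} (h : V =ᶠ[𝓝 x] W) (hV : SmoothFieldOn V U)
    (hU : IsOpen U) (hx : x ∈ U) : D V x = D W x := by
  refine D.isCovariantDerivativeOn.congr_of_eventuallyEq (s := Set.univ)
    (hV.mdifferentiableAt hU hx) ?_ Filter.univ_mem h
  refine (hV.mdifferentiableAt hU hx).congr_of_eventuallyEq ?_
  filter_upwards [h] with y hy
  rw [hy]

theorem covariantDerivative_sub {x : M} (hV : SmoothField V) (hW : SmoothField W) :
    D (fun x => V x - W x) x = D V x - D W x := by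
  have h1 := D.isCovariantDerivativeOn.add (s := Set.univ) (x := x)
    ((hV.sub hW).mdifferentiableAt x) (hW.mdifferentiableAt x)
  have h2 : (fun x => V x - W x) + W = V := by
    funext y
    simp
  rw [h2] at h1
  rw [h1]
  simp

theorem smoothField_covariantDerivative [CovariantDerivative.ContMDiffCovariantDerivative D ∞]
    (hV : SmoothField V) (hX : SmoothField X) : SmoothField fun x => D V x (X x) := by
  have h := (CovariantDerivative.ContMDiffCovariantDerivative.contMDiff
    (cov := D) (k := ∞)).contMDiff (σ := V) (hV.contMDiffOn)
  exact ContMDiff.clm_bundle_apply (contMDiffOn_univ.1 h) hX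

theorem smoothFieldOn_covariantDerivative [FiniteDimensional ℝ E] [T2Space M]
    [CovariantDerivative.ContMDiffCovariantDerivative D ∞] (hU : IsOpen U)
    (hV : SmoothFieldOn V U) (hX : SmoothField X) : SmoothFieldOn (fun x => D V x (X x)) U := by
  intro x hx
  obtain ⟨W, hW, e⟩ := hV.exists_smoothField hU hx
  have h := smoothField_covariantDerivative D hW hX x
  refine (h.congr_of_eventuallyEq ?_).contMDiffWithinAt
  filter_upwards [e.eventuallyEq_nhds] with y hy
  have := covariantDerivative_congr D hy hW.smoothFieldOn isOpen_univ (Set.mem_univ y)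
  rw [this]

end Connections

/-! ### Orthonormal frames and the connection form -/

section LocalFrames

variable {p q : ℕ} {E : Type*} [NormedAddCommGroup E] [NormedSpace ℝ E]
  {M : Type*} [TopologicalSpace M] [ChartedSpace E M]

/-- The derivative of vector-valued functions commutes with continuous linear maps. -/
theorem mvfderiv_clm_comp {F G : Type*} [NormedAddCommGroup F] [NormedSpace ℝ F]
    [NormedAddCommGroup G] [NormedSpace ℝ G] (L : F →L[ℝ] G) {f : M → F} {x : M}
    (hf : MDifferentiableAt 𝓘(ℝ, E) 𝓘(ℝ, F) f x) (v : TangentSpace 𝓘(ℝ, E) x) :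
    mvfderiv 𝓘(ℝ, E) (fun y => L (f y)) x v = L (mvfderiv 𝓘(ℝ, E) f x v) := by
  have h := (L.hasMFDerivAt (x := f x)).comp x hf.hasMFDerivAt
  have h' : mfderiv 𝓘(ℝ, E) 𝓘(ℝ, G) (fun y => L (f y)) x = L ∘L mfderiv 𝓘(ℝ, E) 𝓘(ℝ, F) f x :=
    h.mfderiv
  simp only [mvfderiv, h']
  rfl

theorem sum_coord_smul_single (w : Rpq p q) :
    ∑ a, w a • EuclideanSpace.single a (1 : ℝ) = w := by
  simpa using (EuclideanSpace.basisFun _ ℝ).sum_repr w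

theorem map_eq_sum_coord {F : Type*} [AddCommGroup F] [Module ℝ F] [TopologicalSpace F]
    (L : Rpq p q →L[ℝ] F) (w : Rpq p q) :
    L w = ∑ a, w a • L (EuclideanSpace.single a 1) := by
  conv_lhs => rw [← sum_coord_smul_single w]
  simp

theorem contMDiffOn_clm_of_apply {F : Type*} [NormedAddCommGroup F] [NormedSpace ℝ F]
    {f : M → Rpq p q →L[ℝ] F} {U : Set M}
    (hf : ∀ w, ContMDiffOn 𝓘(ℝ, E) 𝓘(ℝ, F) ∞ (fun x => f x w) U) :
    ContMDiffOn 𝓘(ℝ, E) 𝓘(ℝ, Rpq p q →L[ℝ] F) ∞ f U := by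
  have h : ContMDiffOn 𝓘(ℝ, E) 𝓘(ℝ, Rpq p q →L[ℝ] F) ∞
      (fun x => ∑ a, ContinuousLinearMap.smulRightL ℝ (Rpq p q) F
        (EuclideanSpace.proj a) (f x (EuclideanSpace.single a 1))) U :=
    contMDiffOn_finsetSum fun a _ => (ContinuousLinearMap.smulRightL ℝ (Rpq p q) F
        (EuclideanSpace.proj a)).contMDiff.comp_contMDiffOn (hf _)
  refine h.congr fun x _ => ?_
  ext1 w
  rw [map_eq_sum_coord (f x) w]
  simp

variable [IsManifold 𝓘(ℝ, E) ∞ M] {g : SemiRiemannianMetric p q E M}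
  {s : (x : M) → Rpq p q →L[ℝ] TangentSpace 𝓘(ℝ, E) x} {U : Set M}
  {V W : (x : M) → TangentSpace 𝓘(ℝ, E) x}
  {D : CovariantDerivative 𝓘(ℝ, E) E (TangentSpace 𝓘(ℝ, E) : M → Type _)}

theorem contMDiffOn_metric (hV : SmoothFieldOn V U) (hW : SmoothFieldOn W U) :
    ContMDiffOn 𝓘(ℝ, E) 𝓘(ℝ) ∞ (fun x => g.inner x (V x) (W x)) U := by
  intro x hx
  have h := ContMDiffWithinAt.clm_bundle_apply₂ (F₁ := E) (F₂ := E)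
    (E₃ := Bundle.Trivial M ℝ) (g.contMDiff x).contMDiffWithinAt (hV x hx) (hW x hx)
  simp only [contMDiffWithinAt_totalSpace] at h
  exact h.2

theorem smoothFieldOn_clm_apply (hs : ∀ w, SmoothFieldOn (fun x => s x w) U) {f : M → Rpq p q}
    (hf : ContMDiffOn 𝓘(ℝ, E) 𝓘(ℝ, Rpq p q) ∞ f U) : SmoothFieldOn (fun x => s x (f x)) U := by
  refine (SmoothFieldOn.sum (s := Finset.univ) (V := fun a x =>
    f x a • s x (EuclideanSpace.single a 1)) fun a _ => SmoothFieldOn.smul ?_ (hs _)).congr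
      fun x _ => map_eq_sum_coord _ _
  exact (EuclideanSpace.proj (𝕜 := ℝ) a : Rpq p q →L[ℝ] ℝ).contMDiff.comp_contMDiffOn hf

variable (g s U) in
/-- A smooth local orthonormal frame on an open set `U`, given as a family of isometries from
`ℝ^{p,q}` to the tangent spaces. -/
structure IsOrthonormalFrameOn : Prop where
  isOpen : IsOpen U
  isInvertible : ∀ x ∈ U, (s x).IsInvertible
  isometry : ∀ x ∈ U, ∀ u v, g.inner x (s x u) (s x v) = eta u v
  smooth : ∀ w, SmoothFieldOn (fun x => s x w) U

variable (s D) in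
/-- The matrix of a connection in the frame `s`: the endomorphism `A(v)` of `ℝ^{p,q}` with
`A(v) e_a = s⁻¹ (D_v s_a)`. -/
def connectionForm (x : M) : TangentSpace 𝓘(ℝ, E) x →L[ℝ] (Rpq p q →L[ℝ] Rpq p q) :=
  ∑ a, ContinuousLinearMap.smulRightL ℝ (Rpq p q) (Rpq p q)
      (EuclideanSpace.proj a) ∘L ContinuousLinearMap.inverse (s x) ∘L
        D (fun y => s y (EuclideanSpace.single a 1)) x

theorem connectionForm_eq_sum (x : M) (v : TangentSpace 𝓘(ℝ, E) x) (w : Rpq p q) :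
    connectionForm s D x v w = ∑ a, w a • ContinuousLinearMap.inverse (s x)
      (D (fun y => s y (EuclideanSpace.single a 1)) x v) := by
  simp [connectionForm]

theorem covariantDerivative_sum (hU : IsOpen U) {ι : Type*} (t : Finset ι)
    {V : ι → (x : M) → TangentSpace 𝓘(ℝ, E) x} (hV : ∀ i, SmoothFieldOn (V i) U) {x : M}
    (hx : x ∈ U) : D (fun y => ∑ i ∈ t, V i y) x = ∑ i ∈ t, D (V i) x := by
  classical
  induction t using Finset.induction_on with
  | empty =>
    simp only [Finset.sum_empty]
    exact D.isCovariantDerivativeOn.zero (s := Set.univ) (x := x)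
  | insert i t hi ih =>
    have h := D.isCovariantDerivativeOn.add (s := Set.univ) (x := x)
      ((hV i).mdifferentiableAt hU hx)
      ((SmoothFieldOn.sum fun j (_ : j ∈ t) => hV j).mdifferentiableAt hU hx)
    rw [Finset.sum_insert hi, ← ih, ← h]
    congr 1
    funext y
    simp [Finset.sum_insert hi]

namespace IsOrthonormalFrameOn

theorem mono (hs : IsOrthonormalFrameOn g s U) {U' : Set M} (hU' : IsOpen U') (h : U' ⊆ U) :
    IsOrthonormalFrameOn g s U' where
  isOpen := hU'
  isInvertible x hx := hs.isInvertible x (h hx)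
  isometry x hx := hs.isometry x (h hx)
  smooth w := (hs.smooth w).mono h

theorem smoothFieldOn_apply (hs : IsOrthonormalFrameOn g s U) {f : M → Rpq p q}
    (hf : ContMDiffOn 𝓘(ℝ, E) 𝓘(ℝ, Rpq p q) ∞ f U) : SmoothFieldOn (fun x => s x (f x)) U :=
  smoothFieldOn_clm_apply hs.smooth hf

/-- The coordinates of `V` in the frame `s` are, up to sign, the products of `V` with the vectors
of the frame. -/
theorem contMDiffOn_inverse (hs : IsOrthonormalFrameOn g s U) (hV : SmoothFieldOn V U) :
    ContMDiffOn 𝓘(ℝ, E) 𝓘(ℝ, Rpq p q) ∞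
      (fun x => ContinuousLinearMap.inverse (s x) (V x)) U := by
  have h1 : ∀ w, ContMDiffOn 𝓘(ℝ, E) 𝓘(ℝ) ∞
      (fun x => eta (ContinuousLinearMap.inverse (s x) (V x)) w) U := fun w =>
    (contMDiffOn_metric (g := g) hV (hs.smooth w)).congr fun x hx => by
      rw [← hs.isometry x hx, (hs.isInvertible x hx).self_apply_inverse]
  have h2 : ∀ a, ContMDiffOn 𝓘(ℝ, E) 𝓘(ℝ) ∞
      (fun x => (ContinuousLinearMap.inverse (s x) (V x) : Rpq p q) a) U := by
    rintro (i | j)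
    · simpa only [Frame.eta_single_inl] using h1 (EuclideanSpace.single (Sum.inl i) 1)
    · have h3 : ContMDiffOn 𝓘(ℝ, E) 𝓘(ℝ) ∞
          (fun x => -eta (ContinuousLinearMap.inverse (s x) (V x))
            (EuclideanSpace.single (Sum.inr j) 1)) U :=
        contDiff_neg.contMDiff.comp_contMDiffOn (h1 (EuclideanSpace.single (Sum.inr j) 1))
      simpa only [Frame.eta_single_inr, neg_neg] using h3
  have h4 : ContMDiffOn 𝓘(ℝ, E) 𝓘(ℝ, Rpq p q) ∞
      (fun x => ∑ a, (ContinuousLinearMap.inverse (s x) (V x) : Rpq p q) a •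
        EuclideanSpace.single a (1 : ℝ)) U :=
    contMDiffOn_finsetSum fun a _ => (h2 a).smul contMDiffOn_const
  exact h4.congr fun x _ => (sum_coord_smul_single _).symm

/-- The Leibniz rule in a frame: `D_v (s f) = s (df(v) + A(v) f)`. -/
theorem covariantDerivative_apply (hs : IsOrthonormalFrameOn g s U) {f : M → Rpq p q}
    (hf : ContMDiffOn 𝓘(ℝ, E) 𝓘(ℝ, Rpq p q) ∞ f U) {x : M} (hx : x ∈ U)
    (v : TangentSpace 𝓘(ℝ, E) x) : D (fun y => s y (f y)) x v =
      s x (mvfderiv 𝓘(ℝ, E) f x v + connectionForm s D x v (f x)) := by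
  have hfx : MDifferentiableAt 𝓘(ℝ, E) 𝓘(ℝ, Rpq p q) f x :=
    (hf.contMDiffAt (hs.isOpen.mem_nhds hx)).mdifferentiableAt (by simp)
  have hfa : ∀ a, ContMDiffOn 𝓘(ℝ, E) 𝓘(ℝ) ∞ (fun y => f y a) U := fun a =>
    (EuclideanSpace.proj (𝕜 := ℝ) a : Rpq p q →L[ℝ] ℝ).contMDiff.comp_contMDiffOn hf
  have e : (fun y => s y (f y)) = fun y => ∑ a, f y a • s y (EuclideanSpace.single a 1) :=
    funext fun y => map_eq_sum_coord _ _
  have hd : ∀ a, mvfderiv 𝓘(ℝ, E) (fun y => f y a) x v = mvfderiv 𝓘(ℝ, E) f x v a := fun a =>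
    mvfderiv_clm_comp (EuclideanSpace.proj (𝕜 := ℝ) a : Rpq p q →L[ℝ] ℝ) hfx v
  have hl : ∀ a, D (fun y => f y a • s y (EuclideanSpace.single a 1)) x v =
      f x a • D (fun y => s y (EuclideanSpace.single a 1)) x v +
        mvfderiv 𝓘(ℝ, E) f x v a • s x (EuclideanSpace.single a 1) := fun a => by
    have h := D.isCovariantDerivativeOn.leibniz (s := Set.univ) (x := x)
      ((hs.smooth (EuclideanSpace.single a 1)).mdifferentiableAt hs.isOpen hx)
      (((hfa a).contMDiffAt (hs.isOpen.mem_nhds hx)).mdifferentiableAt (by simp))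
    rw [← hd]
    exact congrArg (fun L => L v) h
  rw [e, covariantDerivative_sum hs.isOpen _
    (fun a => SmoothFieldOn.smul (hfa a) (hs.smooth _)) hx, sum_apply,
    Finset.sum_congr rfl fun a _ => hl a, Finset.sum_add_distrib, map_add, add_comm,
    ← map_eq_sum_coord, connectionForm_eq_sum, map_sum]
  congr 1
  refine Finset.sum_congr rfl fun a _ => ?_
  rw [map_smul, (hs.isInvertible x hx).self_apply_inverse]

theorem covariantDerivative_const (hs : IsOrthonormalFrameOn g s U) {x : M} (hx : x ∈ U)
    (v : TangentSpace 𝓘(ℝ, E) x) (w : Rpq p q) :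
    D (fun y => s y w) x v = s x (connectionForm s D x v w) := by
  have h := hs.covariantDerivative_apply (D := D) (f := fun _ => w) contMDiffOn_const hx v
  rwa [mvfderiv_const, zero_apply, zero_add] at h

/-- The transformation rule of the connection form under a change of frame `s' = s k`. -/
theorem connectionForm_gauge (hs : IsOrthonormalFrameOn g s U)
    {U' : Set M} {s' : (x : M) → Rpq p q →L[ℝ] TangentSpace 𝓘(ℝ, E) x}
    (hs' : IsOrthonormalFrameOn g s' U') {k : M → Lorentz p q}
    (hk : ∀ x ∈ U ∩ U', s' x = s x ∘L toEnd (k x)) {x : M} (hx : x ∈ U ∩ U')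
    (v : TangentSpace 𝓘(ℝ, E) x) :
    connectionForm s D x v = toEnd (k x) ∘L connectionForm s' D x v ∘L toEnd (k x)⁻¹
      + toEnd (k x) ∘L mvfderiv 𝓘(ℝ, E) (fun y => toEnd (k y)⁻¹) x v := by
  have ht := hs'.mono (hs.isOpen.inter hs'.isOpen) Set.inter_subset_right
  have hkinv : ∀ (y : M) (w : Rpq p q), toEnd (k y) (toEnd (k y)⁻¹ w) = w := fun y w =>
    (k y).1.apply_symm_apply w
  have e : ∀ y ∈ U ∩ U', ∀ w, s y w = s' y (toEnd (k y)⁻¹ w) := fun y hy w => by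
    rw [hk y hy, ContinuousLinearMap.comp_apply, hkinv]
  -- No smoothness of `k` is assumed: `k⁻¹` is smooth as the matrix of `s` in the frame `s'`.
  have hw : ∀ w, ContMDiffOn 𝓘(ℝ, E) 𝓘(ℝ, Rpq p q) ∞ (fun y => toEnd (k y)⁻¹ w) (U ∩ U') :=
    fun w => (ht.contMDiffOn_inverse ((hs.smooth w).mono Set.inter_subset_left)).congr
      fun y hy => by rw [e y hy, (hs'.isInvertible y hy.2).inverse_apply_self]
  have hd := ((contMDiffOn_clm_of_apply hw).contMDiffAt
    (ht.isOpen.mem_nhds hx)).mdifferentiableAt (by simp)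
  ext1 w
  -- Both sides arise from expanding `D_v (s w) = D_v (s' (k⁻¹ w))` in the frame `s` and in `s'`.
  have h1 := hs.covariantDerivative_const (D := D) hx.1 v w
  have e2 : (fun y => s y w) =ᶠ[𝓝 x] fun y => s' y (toEnd (k y)⁻¹ w) := by
    filter_upwards [ht.isOpen.mem_nhds hx] with y hy using e y hy w
  rw [covariantDerivative_congr D e2 (hs.smooth w) hs.isOpen hx.1,
    ht.covariantDerivative_apply (hw w) hx, hk x hx] at h1
  have h2 := congrArg (ContinuousLinearMap.inverse (s x)) h1
  have h3 : mvfderiv 𝓘(ℝ, E) (fun y => toEnd (k y)⁻¹ w) x v =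
      mvfderiv 𝓘(ℝ, E) (fun y => toEnd (k y)⁻¹) x v w :=
    mvfderiv_clm_comp (ContinuousLinearMap.apply ℝ (Rpq p q) w) hd v
  rw [ContinuousLinearMap.comp_apply, (hs.isInvertible x hx.1).inverse_apply_self,
    (hs.isInvertible x hx.1).inverse_apply_self, h3] at h2
  rw [← h2, map_add, add_comm]
  rfl

/-- Coordinates in two frames `s` and `s' = s k`. -/
theorem inverse_apply_gauge (hs : IsOrthonormalFrameOn g s U)
    {U' : Set M} {s' : (x : M) → Rpq p q →L[ℝ] TangentSpace 𝓘(ℝ, E) x}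
    (hs' : IsOrthonormalFrameOn g s' U') {x : M} {k : Lorentz p q} (hk : s' x = s x ∘L toEnd k)
    (hx : x ∈ U ∩ U') (v : TangentSpace 𝓘(ℝ, E) x) :
    ContinuousLinearMap.inverse (s x) v = toEnd k (ContinuousLinearMap.inverse (s' x) v) := by
  have h := congrArg (ContinuousLinearMap.inverse (s x))
    ((hs'.isInvertible x hx.2).self_apply_inverse v)
  rw [hk, ContinuousLinearMap.comp_apply, (hs.isInvertible x hx.1).inverse_apply_self, ← hk] at h
  exact h.symm

end IsOrthonormalFrameOn

end LocalFrames

/-! ### The Bianchi identity and the structure equations -/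

section FrameIdentities

variable {p q : ℕ} {E : Type*} [NormedAddCommGroup E] [NormedSpace ℝ E] [FiniteDimensional ℝ E]
  {M : Type*} [TopologicalSpace M] [ChartedSpace E M] [IsManifold 𝓘(ℝ, E) ∞ M]
  {g : SemiRiemannianMetric p q E M}
  {s s' : (x : M) → Rpq p q →L[ℝ] TangentSpace 𝓘(ℝ, E) x} {U U' : Set M}
  {V W X Y Z : (x : M) → TangentSpace 𝓘(ℝ, E) x}
  {D : CovariantDerivative 𝓘(ℝ, E) E (TangentSpace 𝓘(ℝ, E) : M → Type _)}

theorem torsion_smoothField_apply (hX : SmoothField X) (hY : SmoothField Y) (x : M) :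
    D.torsion x (X x) (Y x) =
      D Y x (X x) - D X x (Y x) - VectorField.mlieBracket 𝓘(ℝ, E) X Y x :=
  D.torsion_apply (hX.mdifferentiableAt x) (hY.mdifferentiableAt x)

section Smooth

variable [CovariantDerivative.ContMDiffCovariantDerivative D ∞]

theorem smoothField_torsion (hX : SmoothField X) (hY : SmoothField Y) :
    SmoothField fun x => D.torsion x (X x) (Y x) := by
  have e : (fun x => D.torsion x (X x) (Y x)) = fun x =>
      D Y x (X x) - D X x (Y x) - VectorField.mlieBracket 𝓘(ℝ, E) X Y x :=
    funext fun x => torsion_smoothField_apply hX hY x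
  rw [e]
  exact ((smoothField_covariantDerivative D hY hX).sub
    (smoothField_covariantDerivative D hX hY)).sub (hX.mlieBracket hY)

/-- The first Bianchi identity `d_D T = R ∧ id` for a connection with `R = 0`: after inserting the
definition of `T`, the second covariant derivatives form curvatures and the iterated brackets
cancel by the Jacobi identity. -/
theorem bianchi_of_isFlatConnection (hflat : IsFlatConnection D) (hX : SmoothField X)
    (hY : SmoothField Y) (hZ : SmoothField Z) (x : M) :
    D (fun y => D.torsion y (Y y) (Z y)) x (X x) - D (fun y => D.torsion y (X y) (Z y)) x (Y x)
      + D (fun y => D.torsion y (X y) (Y y)) x (Z x)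
      - D.torsion x (VectorField.mlieBracket 𝓘(ℝ, E) X Y x) (Z x)
      + D.torsion x (VectorField.mlieBracket 𝓘(ℝ, E) X Z x) (Y x)
      - D.torsion x (VectorField.mlieBracket 𝓘(ℝ, E) Y Z x) (X x) = 0 := by
  have hT : ∀ {A B C : (x : M) → TangentSpace 𝓘(ℝ, E) x}, SmoothField A → SmoothField B →
      D (fun y => D.torsion y (A y) (B y)) x (C x) =
        D (fun y => D B y (A y)) x (C x) - D (fun y => D A y (B y)) x (C x)
          - D (VectorField.mlieBracket 𝓘(ℝ, E) A B) x (C x) := by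
    intro A B C hA hB
    have e : (fun x => D.torsion x (A x) (B x)) = fun x =>
        D B x (A x) - D A x (B x) - VectorField.mlieBracket 𝓘(ℝ, E) A B x :=
      funext fun x => torsion_smoothField_apply hA hB x
    have h1 := smoothField_covariantDerivative D hB hA
    have h2 := smoothField_covariantDerivative D hA hB
    rw [e, covariantDerivative_sub D (h1.sub h2) (hA.mlieBracket hB),
      covariantDerivative_sub D h1 h2]
    rfl
  have h1 := hflat X Y Z hX hY hZ x
  have h2 := hflat X Z Y hX hZ hY x
  have h3 := hflat Y Z X hY hZ hX x
  have hJ : VectorField.mlieBracket 𝓘(ℝ, E) X (VectorField.mlieBracket 𝓘(ℝ, E) Y Z) x =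
      VectorField.mlieBracket 𝓘(ℝ, E) (VectorField.mlieBracket 𝓘(ℝ, E) X Y) Z x +
        VectorField.mlieBracket 𝓘(ℝ, E) Y (VectorField.mlieBracket 𝓘(ℝ, E) X Z) x := by
    have h : IsManifold 𝓘(ℝ, E) (minSmoothness ℝ 3) M :=
      IsManifold.of_le (n := ∞) (by simpa using ENat.LEInfty.out)
    have h2 : minSmoothness ℝ 2 ≤ (∞ : ℕ∞ω) := by simpa using ENat.LEInfty.out
    exact VectorField.leibniz_identity_mlieBracket_apply ((hX x).of_le h2) ((hY x).of_le h2)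
      ((hZ x).of_le h2)
  rw [VectorField.mlieBracket_swap_apply (V := X) (W := VectorField.mlieBracket 𝓘(ℝ, E) Y Z),
    VectorField.mlieBracket_swap_apply (V := Y) (W := VectorField.mlieBracket 𝓘(ℝ, E) X Z)] at hJ
  rw [hT hY hZ, hT hX hZ, hT hX hY, torsion_smoothField_apply (hX.mlieBracket hY) hZ,
    torsion_smoothField_apply (hX.mlieBracket hZ) hY,
    torsion_smoothField_apply (hY.mlieBracket hZ) hX]
  -- What is left is linear in the second derivatives, the iterated brackets and the terms
  -- `D_{[X,Y]} Z`.
  generalize D (fun y => D Z y (Y y)) x (X x) = a1 at *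
  generalize D (fun y => D Z y (X y)) x (Y x) = a2 at *
  generalize D (fun y => D Y y (Z y)) x (X x) = a3 at *
  generalize D (fun y => D Y y (X y)) x (Z x) = a4 at *
  generalize D (fun y => D X y (Z y)) x (Y x) = a5 at *
  generalize D (fun y => D X y (Y y)) x (Z x) = a6 at *
  generalize VectorField.mlieBracket 𝓘(ℝ, E) (VectorField.mlieBracket 𝓘(ℝ, E) Y Z) X x = b1 at *
  generalize VectorField.mlieBracket 𝓘(ℝ, E) (VectorField.mlieBracket 𝓘(ℝ, E) X Z) Y x = b2 at *
  generalize VectorField.mlieBracket 𝓘(ℝ, E) (VectorField.mlieBracket 𝓘(ℝ, E) X Y) Z x = b3 at *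
  linear_combination (norm := abel) h1 - h2 + h3 - hJ

namespace IsOrthonormalFrameOn

/-- For `B = s⁻¹ T`, the 2-curvature `dB + A ∧ B` is `s⁻¹` of the exterior covariant derivative of
the torsion, which vanishes by the Bianchi identity. -/
theorem twoCurvatureForm_torsion (hs : IsOrthonormalFrameOn g s U) (hflat : IsFlatConnection D)
    (hX : SmoothField X) (hY : SmoothField Y) (hZ : SmoothField Z) {x : M} (hx : x ∈ U) :
    twoCurvatureForm (connectionForm s D) (fun x => ContinuousLinearMap.postcomp
      (TangentSpace 𝓘(ℝ, E) x) (ContinuousLinearMap.inverse (s x)) ∘L D.torsion x) X Y Z x = 0 := by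
  have h1 : ∀ {A B C : (x : M) → TangentSpace 𝓘(ℝ, E) x}, SmoothField A → SmoothField B →
      mvfderiv 𝓘(ℝ, E) (fun y => ContinuousLinearMap.inverse (s y) (D.torsion y (A y) (B y))) x
          (C x) + connectionForm s D x (C x)
            (ContinuousLinearMap.inverse (s x) (D.torsion x (A x) (B x))) =
        ContinuousLinearMap.inverse (s x) (D (fun y => D.torsion y (A y) (B y)) x (C x)) := by
    intro A B C hA hB
    have hT : SmoothFieldOn (fun x => D.torsion x (A x) (B x)) U :=
      (smoothField_torsion hA hB).smoothFieldOn
    have h := hs.covariantDerivative_apply (D := D) (hs.contMDiffOn_inverse hT) hx (C x)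
    rw [covariantDerivative_congr D (W := fun y => D.torsion y (A y) (B y)) ?_
      (hs.smoothFieldOn_apply (hs.contMDiffOn_inverse hT)) hs.isOpen hx] at h
    · rw [h, (hs.isInvertible x hx).inverse_apply_self]
    · filter_upwards [hs.isOpen.mem_nhds hx] with y hy
      rw [(hs.isInvertible y hy).self_apply_inverse]
  have h2 := congrArg (ContinuousLinearMap.inverse (s x))
    (bianchi_of_isFlatConnection hflat hX hY hZ x)
  simp only [map_add, map_sub, map_zero, ← h1 hY hZ, ← h1 hX hZ, ← h1 hX hY] at h2
  rw [← h2]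
  simp only [twoCurvatureForm, extDerivTwoForm, alphaLie, ContinuousLinearMap.comp_apply,
    ContinuousLinearMap.postcomp_apply, ContinuousLinearMap.id_apply]
  abel

end IsOrthonormalFrameOn

variable [T2Space M]

/-- Vanishing of the curvature on a field that is only locally defined. -/
theorem IsFlatConnection.eq_of_smoothFieldOn (hflat : IsFlatConnection D) (hX : SmoothField X)
    (hY : SmoothField Y) (hU : IsOpen U) (hV : SmoothFieldOn V U) {x : M} (hx : x ∈ U) :
    D (fun y => D V y (Y y)) x (X x) - D (fun y => D V y (X y)) x (Y x)
      - D V x (VectorField.mlieBracket 𝓘(ℝ, E) X Y x) = 0 := by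
  obtain ⟨Z, hZ, e⟩ := hV.exists_smoothField hU hx
  have h1 : ∀ {C : (x : M) → TangentSpace 𝓘(ℝ, E) x}, SmoothField C →
      D (fun y => D Z y (C y)) x = D (fun y => D V y (C y)) x := fun hC => by
    refine covariantDerivative_congr D ?_ (smoothField_covariantDerivative D hZ hC).smoothFieldOn
      isOpen_univ (Set.mem_univ x)
    filter_upwards [e.eventuallyEq_nhds] with y hy
    rw [covariantDerivative_congr D hy hZ.smoothFieldOn isOpen_univ (Set.mem_univ y)]
  have h2 := hflat X Y Z hX hY hZ x
  rwa [h1 hY, h1 hX, covariantDerivative_congr D e hZ.smoothFieldOn isOpen_univ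
    (Set.mem_univ x)] at h2

namespace IsOrthonormalFrameOn

theorem contMDiffOn_connectionForm (hs : IsOrthonormalFrameOn g s U) (hX : SmoothField X) :
    ContMDiffOn 𝓘(ℝ, E) 𝓘(ℝ, Rpq p q →L[ℝ] Rpq p q) ∞
      (fun x => connectionForm s D x (X x)) U := by
  refine contMDiffOn_clm_of_apply fun w => ?_
  refine (hs.contMDiffOn_inverse (smoothFieldOn_covariantDerivative D hs.isOpen (hs.smooth w)
    hX)).congr fun x hx => ?_
  rw [hs.covariantDerivative_const hx, (hs.isInvertible x hx).inverse_apply_self]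

/-- The structure equation: `dA + A ∧ A` is the matrix of the curvature of `D` in the frame `s`,
and vanishes for a flat `D`. -/
theorem curvatureForm_connectionForm (hs : IsOrthonormalFrameOn g s U) (hflat : IsFlatConnection D)
    (hX : SmoothField X) (hY : SmoothField Y) {x : M} (hx : x ∈ U) :
    curvatureForm (connectionForm s D) X Y x = 0 := by
  have h1 : ∀ {B C : (x : M) → TangentSpace 𝓘(ℝ, E) x} (w : Rpq p q), SmoothField B →
      D (fun y => D (fun z => s z w) y (B y)) x (C x) =
        s x (mvfderiv 𝓘(ℝ, E) (fun y => connectionForm s D y (B y)) x (C x) w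
          + connectionForm s D x (C x) (connectionForm s D x (B x) w)) := by
    intro B C w hB
    have hA := hs.contMDiffOn_connectionForm (D := D) hB
    let L : (Rpq p q →L[ℝ] Rpq p q) →L[ℝ] Rpq p q := ContinuousLinearMap.apply ℝ (Rpq p q) w
    have hAw : ContMDiffOn 𝓘(ℝ, E) 𝓘(ℝ, Rpq p q) ∞ (fun y => connectionForm s D y (B y) w) U :=
      L.contMDiff.comp_contMDiffOn hA
    have e : (fun y => D (fun z => s z w) y (B y)) =ᶠ[𝓝 x]
        fun y => s y (connectionForm s D y (B y) w) := by
      filter_upwards [hs.isOpen.mem_nhds hx] with y hy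
      exact hs.covariantDerivative_const hy _ _
    rw [covariantDerivative_congr D e
      (smoothFieldOn_covariantDerivative D hs.isOpen (hs.smooth w) hB) hs.isOpen hx,
      hs.covariantDerivative_apply hAw hx]
    congr 2
    exact mvfderiv_clm_comp L
      ((hA.contMDiffAt (hs.isOpen.mem_nhds hx)).mdifferentiableAt (by simp)) (C x)
  ext1 w
  have h2 := hflat.eq_of_smoothFieldOn hX hY hs.isOpen (hs.smooth w) hx
  rw [h1 w hY, h1 w hX, hs.covariantDerivative_const hx, ← map_sub, ← map_sub] at h2
  have h3 := congrArg (ContinuousLinearMap.inverse (s x)) h2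
  rw [(hs.isInvertible x hx).inverse_apply_self, map_zero] at h3
  rw [zero_apply, ← h3]
  simp only [curvatureForm, add_apply, sub_apply, ContinuousLinearMap.comp_apply]
  abel

end IsOrthonormalFrameOn

end Smooth

namespace IsOrthonormalFrameOn

/-- The products of the vectors of an orthonormal frame are constant, so that compatibility of `D`
with the metric makes the connection form skew for `η`. -/
theorem connectionForm_mem_lorentzAlgebra [T2Space M] (hs : IsOrthonormalFrameOn g s U)
    (hmetric : IsMetricCompatible g D) {x : M} (hx : x ∈ U) (v : TangentSpace 𝓘(ℝ, E) x) :
    connectionForm s D x v ∈ lorentzAlgebra p q := by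
  intro u w
  obtain ⟨X, hX, rfl⟩ := exists_smoothField_apply_eq x v
  obtain ⟨Y, hY, eY⟩ := (hs.smooth u).exists_smoothField hs.isOpen hx
  obtain ⟨Z, hZ, eZ⟩ := (hs.smooth w).exists_smoothField hs.isOpen hx
  have h := hmetric X Y Z hX hY hZ x
  have e : (fun y => g.inner y (Y y) (Z y)) =ᶠ[𝓝 x] fun _ => eta u w := by
    filter_upwards [hs.isOpen.mem_nhds hx, eY, eZ] with y hy h1 h2
    rw [h1, h2, hs.isometry y hy]
  have h0 : mvfderiv 𝓘(ℝ, E) (fun y => g.inner y (Y y) (Z y)) x (X x) = 0 := by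
    have e2 : mfderiv 𝓘(ℝ, E) 𝓘(ℝ) (fun y => g.inner y (Y y) (Z y)) x = 0 :=
      e.mfderiv_eq.trans mfderiv_const
    simp [mvfderiv, e2]
  rw [h0, covariantDerivative_congr D eY hY.smoothFieldOn isOpen_univ (Set.mem_univ x),
    covariantDerivative_congr D eZ hZ.smoothFieldOn isOpen_univ (Set.mem_univ x),
    eY.self_of_nhds, eZ.self_of_nhds, hs.covariantDerivative_const hx,
    hs.covariantDerivative_const hx, hs.isometry x hx, hs.isometry x hx] at h
  exact h.symm

end IsOrthonormalFrameOn

end FrameIdentities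

/-! ### Sections of a principal space trivialize the associated 2-bundle -/

universe u v w

namespace PrincipalSpace

section

variable {𝔾 : Smooth2Group.{v}} {M : Type w} [DiffeologicalSpace M]
  (P : PrincipalSpace.{u} 𝔾.Ob M) {U : Set M} (σ : {x : M // x ∈ U} → P.P)

theorem mkMor_inj {x : P.P} {f k : 𝔾.Mor} (h : P.mkMor x f = P.mkMor x k) : f = k := by
  obtain ⟨g, h1, h2⟩ := Quotient.exact (s := P.setoidMor) h
  have : g = 1 := P.free x _ _ (by rw [← h1, P.act_one])
  simpa [this, ident_one] using h2

theorem proj_section_mem (hσ : ∀ x, P.proj (σ x) = x) (x : {x : M // x ∈ U}) :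
    P.proj (σ x) ∈ U := by
  rw [hσ]
  exact x.2

/-- The representative of an object over `U` whose first component lies on the section `σ`. -/
theorem mkOb_eq_sectionAt (hσ : ∀ x, P.proj (σ x) = x) (φ : P.P) (a : 𝔾.Ob) (h : P.proj φ ∈ U) :
    P.mkOb φ a = P.mkOb (σ ⟨P.proj φ, h⟩) (P.div (σ ⟨P.proj φ, h⟩) φ (hσ _) * a) := by
  rw [← mkOb_act, P.act_div]

/-- The representative of a morphism over `U` whose first component lies on the section `σ`. -/
theorem mkMor_eq_sectionAt (hσ : ∀ x, P.proj (σ x) = x) (φ : P.P) (f : 𝔾.Mor)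
    (h : P.proj φ ∈ U) : P.mkMor φ f =
      P.mkMor (σ ⟨P.proj φ, h⟩) (𝔾.ident (P.div (σ ⟨P.proj φ, h⟩) φ (hσ _)) * f) := by
  rw [← mkMor_act, P.act_div]

/-- The bijection `(x, a) ↦ [σ x, a]` on objects over `U` given by a section `σ` over `U`. -/
def sectionEquivOb (hσ : ∀ x, P.proj (σ x) = x) :
    {x : M // x ∈ U} × 𝔾.Ob ≃ {a : P.assoc.Ob // P.assoc.proj a ∈ U} :=
  Equiv.ofBijective (fun z => ⟨P.mkOb (σ z.1) z.2, proj_section_mem P σ hσ z.1⟩) <| by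
    constructor
    · rintro ⟨x, a⟩ ⟨y, b⟩ h
      have h1 : P.mkOb (σ x) a = P.mkOb (σ y) b := congrArg Subtype.val h
      have h2 : P.proj (σ x) = P.proj (σ y) := congrArg P.assoc.proj h1
      rw [hσ, hσ] at h2
      obtain rfl := Subtype.ext h2
      rw [P.mkOb_inj h1]
    · rintro ⟨⟨φ, a⟩, h⟩
      exact ⟨(⟨P.proj φ, h⟩, _), Subtype.ext (P.mkOb_eq_sectionAt σ hσ φ a h).symm⟩

/-- The bijection `(x, f) ↦ [σ x, f]` on morphisms over `U` given by a section `σ` over `U`. -/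
def sectionEquivMor (hσ : ∀ x, P.proj (σ x) = x) :
    {x : M // x ∈ U} × 𝔾.Mor ≃ {f : P.assoc.Mor // P.assoc.proj (P.assoc.src f) ∈ U} :=
  Equiv.ofBijective (fun z => ⟨P.mkMor (σ z.1) z.2, proj_section_mem P σ hσ z.1⟩) <| by
    constructor
    · rintro ⟨x, a⟩ ⟨y, b⟩ h
      have h1 : P.mkMor (σ x) a = P.mkMor (σ y) b := congrArg Subtype.val h
      have h2 : P.proj (σ x) = P.proj (σ y) :=
        congrArg (fun f => P.assoc.proj (P.assoc.src f)) h1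
      rw [hσ, hσ] at h2
      obtain rfl := Subtype.ext h2
      rw [P.mkMor_inj h1]
    · rintro ⟨⟨φ, a⟩, h⟩
      exact ⟨(⟨P.proj φ, h⟩, _), Subtype.ext (P.mkMor_eq_sectionAt σ hσ φ a h).symm⟩

variable {σ}

theorem dSmooth_sectionEquivOb (hσ : ∀ x, P.proj (σ x) = x) (hs : DSmooth σ) :
    DSmooth (P.sectionEquivOb σ hσ) :=
  dSmooth_subtypeMk (dSmooth_mk.comp (dSmooth_prodMk (hs.comp dSmooth_fst) dSmooth_snd)) _

theorem dSmooth_sectionEquivMor (hσ : ∀ x, P.proj (σ x) = x) (hs : DSmooth σ) :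
    DSmooth (P.sectionEquivMor σ hσ) :=
  dSmooth_subtypeMk (dSmooth_mk.comp (dSmooth_prodMk (hs.comp dSmooth_fst) dSmooth_snd)) _

/-- A smooth family `φ` in `P` over `U` differs from the section `σ` by a smooth family in the
structure group. -/
theorem isPlot_div_sectionAt (hσ : ∀ x, P.proj (σ x) = x) (hs : DSmooth σ) {n : ℕ}
    {φ : EuclideanSpace ℝ (Fin n) → P.P} (hφ : IsPlot φ) (h : ∀ z, P.proj (φ z) ∈ U) :
    IsPlot fun z => P.div (σ ⟨P.proj (φ z), h z⟩) (φ z) (hσ _) := by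
  have h1 : IsPlot fun z => (⟨P.proj (φ z), h z⟩ : {x : M // x ∈ U}) :=
    fun _ => P.smooth_proj _ _ hφ
  exact P.smooth_div _ (fun z => ⟨(σ ⟨P.proj (φ z), h z⟩, φ z), hσ _⟩)
    fun _ => ⟨hs _ _ h1, hφ⟩

/-- A plot of the quotient lifts locally to a plot `r` of pairs in `P × 𝔾₀`, and the inverse of
`(x, a) ↦ [σ x, a]` is computed on `r` by the division map of `P`. -/
theorem dSmooth_sectionEquivOb_symm (hσ : ∀ x, P.proj (σ x) = x) (hs : DSmooth σ) :
    DSmooth (P.sectionEquivOb σ hσ).symm := fun n p hp => DiffeologicalSpace.locality fun z => by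
  obtain ⟨V, hV, hz, H⟩ := hp () z
  refine ⟨V, hV, hz, fun {m f} hf hc => ?_⟩
  obtain ⟨r, hr, e⟩ := H m f hf hc
  have e' : ∀ y, (p (f y)).1 = P.mkOb (r y).1 (r y).2 := e
  have hU : ∀ y, P.proj (r y).1 ∈ U := fun y => by
    have h := (p (f y)).2
    rwa [e' y] at h
  have key : (P.sectionEquivOb σ hσ).symm ∘ p ∘ f = fun y => (⟨P.proj (r y).1, hU y⟩,
      P.div (σ ⟨P.proj (r y).1, hU y⟩) (r y).1 (hσ _) * (r y).2) := by
    funext y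
    refine (Equiv.symm_apply_eq _).2 (Subtype.ext ?_)
    exact (e' y).trans (P.mkOb_eq_sectionAt σ hσ _ _ (hU y))
  change IsPlot ((P.sectionEquivOb σ hσ).symm ∘ p ∘ f)
  rw [key]
  exact ⟨fun _ => P.smooth_proj _ _ hr.1,
    𝔾.smooth_mulOb m (fun y => (_, (r y).2)) ⟨P.isPlot_div_sectionAt hσ hs hr.1 hU, hr.2⟩⟩

theorem dSmooth_sectionEquivMor_symm (hσ : ∀ x, P.proj (σ x) = x) (hs : DSmooth σ) :
    DSmooth (P.sectionEquivMor σ hσ).symm := fun n p hp => DiffeologicalSpace.locality fun z => by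
  obtain ⟨V, hV, hz, H⟩ := hp () z
  refine ⟨V, hV, hz, fun {m f} hf hc => ?_⟩
  obtain ⟨r, hr, e⟩ := H m f hf hc
  have e' : ∀ y, (p (f y)).1 = P.mkMor (r y).1 (r y).2 := e
  have hU : ∀ y, P.proj (r y).1 ∈ U := fun y => by
    have h := (p (f y)).2
    rwa [e' y] at h
  have key : (P.sectionEquivMor σ hσ).symm ∘ p ∘ f = fun y => (⟨P.proj (r y).1, hU y⟩,
      𝔾.ident (P.div (σ ⟨P.proj (r y).1, hU y⟩) (r y).1 (hσ _)) * (r y).2) := by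
    funext y
    refine (Equiv.symm_apply_eq _).2 (Subtype.ext ?_)
    exact (e' y).trans (P.mkMor_eq_sectionAt σ hσ _ _ (hU y))
  change IsPlot ((P.sectionEquivMor σ hσ).symm ∘ p ∘ f)
  rw [key]
  exact ⟨fun _ => P.smooth_proj _ _ hr.1,
    𝔾.smooth_mulMor m (fun y => (_, (r y).2))
      ⟨𝔾.smooth_ident _ _ (P.isPlot_div_sectionAt hσ hs hr.1 hU), hr.2⟩⟩

end

/-- A smooth section of `P` over an open set trivializes `P ×_G 𝔾` there. -/
def localTrivOfSection {𝔾 : Smooth2Group.{v}} {M : Type w} [TopologicalSpace M]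
    [DiffeologicalSpace M] (P : PrincipalSpace.{u} 𝔾.Ob M) {U : Set M} (hU : IsOpen U)
    (σ : {x : M // x ∈ U} → P.P) (hσ : ∀ x, P.proj (σ x) = x) (hs : DSmooth σ) :
    LocalTriv P.assoc where
  U := U
  isOpen := hU
  onOb := (P.sectionEquivOb σ hσ).symm
  onMor := (P.sectionEquivMor σ hσ).symm
  smooth_onOb := P.dSmooth_sectionEquivOb_symm hσ hs
  smooth_onOb_symm := P.dSmooth_sectionEquivOb hσ hs
  smooth_onMor := P.dSmooth_sectionEquivMor_symm hσ hs
  smooth_onMor_symm := P.dSmooth_sectionEquivMor hσ hs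
  proj_onOb a := by
    obtain ⟨z, rfl⟩ := (P.sectionEquivOb σ hσ).surjective a
    rw [Equiv.symm_apply_apply]
    exact (hσ z.1).symm
  proj_onMor f := by
    obtain ⟨z, rfl⟩ := (P.sectionEquivMor σ hσ).surjective f
    rw [Equiv.symm_apply_apply]
    exact (hσ z.1).symm
  src_onMor f := by
    obtain ⟨z, rfl⟩ := (P.sectionEquivMor σ hσ).surjective f
    rw [Equiv.symm_apply_apply]
    exact congrArg Prod.snd ((P.sectionEquivOb σ hσ).symm_apply_apply (z.1, 𝔾.src z.2)).symm
  tgt_onMor f := by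
    obtain ⟨z, rfl⟩ := (P.sectionEquivMor σ hσ).surjective f
    rw [Equiv.symm_apply_apply]
    exact congrArg Prod.snd ((P.sectionEquivOb σ hσ).symm_apply_apply (z.1, 𝔾.tgt z.2)).symm
  ident_onMor a := by
    obtain ⟨z, rfl⟩ := (P.sectionEquivOb σ hσ).surjective a
    rw [Equiv.symm_apply_apply]
    exact congrArg Prod.snd ((P.sectionEquivMor σ hσ).symm_apply_apply (z.1, 𝔾.ident z.2))
  comp_onMor f f' h h' := by
    obtain ⟨⟨x, m⟩, rfl⟩ := (P.sectionEquivMor σ hσ).surjective f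
    obtain ⟨⟨x', m'⟩, rfl⟩ := (P.sectionEquivMor σ hσ).surjective f'
    have h1 : P.assocSrc (P.mkMor (σ x) m) = P.assocTgt (P.mkMor (σ x') m') := h
    have h2 : P.proj (σ x) = P.proj (σ x') := congrArg P.assoc.proj h1
    rw [hσ, hσ] at h2
    obtain rfl := Subtype.ext h2
    have h3 := P.mk_src_tgt h1
    have e : ∀ h4, (P.sectionEquivMor σ hσ).symm
        ⟨P.assoc.comp (P.mkMor (σ x) m) (P.mkMor (σ x) m') h1, h4⟩ = (x, 𝔾.comp m m' h3) :=
      fun h4 => (Equiv.symm_apply_eq _).2 (Subtype.ext (P.assocComp_mk (σ x) m m' h3 h1))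
    refine (congrArg Prod.snd (e _)).trans (comp_congr ?_ ?_ _ _)
    · rw [Equiv.symm_apply_apply]
    · rw [Equiv.symm_apply_apply]
  act_onOb a g := by
    obtain ⟨z, rfl⟩ := (P.sectionEquivOb σ hσ).surjective a
    rw [Equiv.symm_apply_apply]
    exact congrArg Prod.snd ((P.sectionEquivOb σ hσ).symm_apply_apply (z.1, z.2 * g))
  act_onMor f g := by
    obtain ⟨z, rfl⟩ := (P.sectionEquivMor σ hσ).surjective f
    rw [Equiv.symm_apply_apply]
    exact congrArg Prod.snd ((P.sectionEquivMor σ hσ).symm_apply_apply (z.1, z.2 * g))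

end PrincipalSpace

/-- On an overlap, `t'⁻¹(x, 1) = t⁻¹(x, 1) g_{tt'}(x)`. -/
theorem LocalTriv.sect_eq_actOb {𝔾 : Smooth2Group.{v}} {M : Type w} [TopologicalSpace M]
    [DiffeologicalSpace M] {P : TwoSpaceOver.{u} 𝔾 M} (t t' : LocalTriv P) {x : M}
    (hx : x ∈ t.U) (hx' : x ∈ t'.U) :
    t'.sect x hx' = P.actOb (t.sect x hx) (t.transition t' x) := by
  have h1 : P.proj (t'.sect x hx') ∈ t.U := (t'.proj_sect x hx').symm ▸ hx
  have h2 : P.proj (t.sect x hx) ∈ t.U := (t.proj_sect x hx).symm ▸ hx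
  have h3 : P.proj (P.actOb (t.sect x hx) (t.transition t' x)) ∈ t.U :=
    (P.proj_act _ _).symm ▸ h2
  have h4 : t.onOb ⟨t.sect x hx, h2⟩ = (⟨x, hx⟩, 1) := t.onOb.apply_symm_apply _
  refine congrArg Subtype.val (a₁ := ⟨_, h1⟩) (a₂ := ⟨_, h3⟩) (t.onOb.injective (Prod.ext ?_ ?_))
  · refine Subtype.ext ?_
    rw [t.proj_onOb, t.proj_onOb, P.proj_act, t.proj_sect, t'.proj_sect]
  · rw [t.act_onOb ⟨t.sect x hx, h2⟩, h4, one_mul, LocalTriv.transition, dif_pos ⟨hx, hx'⟩]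

theorem LocalTriv.dSmooth_sect {𝔾 : Smooth2Group.{v}} {M : Type w} [TopologicalSpace M]
    [DiffeologicalSpace M] {P : TwoSpaceOver.{u} 𝔾 M} (t : LocalTriv P) :
    DSmooth fun x : {x : M // x ∈ t.U} => t.sect x.1 x.2 :=
  PrincipalSpace.dSmooth_val.comp (t.smooth_onOb_symm.comp
    (PrincipalSpace.dSmooth_prodMk dSmooth_id dSmooth_const))

/-! ### The frame of a local trivialization -/

section FramesOfTrivializations

variable {p q : ℕ} {E : Type*} [NormedAddCommGroup E] [NormedSpace ℝ E]
  {M : Type*} [TopologicalSpace M] [ChartedSpace E M] [IsManifold 𝓘(ℝ, E) ∞ M]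
  {g : SemiRiemannianMetric p q E M}

/-- Smoothness on an open subset of a manifold can be tested on plots: near each point, a chart
and a diffeomorphism of a ball with the whole space give a plot with a smooth local inverse. -/
theorem contMDiffOn_of_forall_plot [FiniteDimensional ℝ E] {E' : Type*} [NormedAddCommGroup E']
    [NormedSpace ℝ E'] {H' : Type*} [TopologicalSpace H'] {I' : ModelWithCorners ℝ E' H'}
    {N : Type*} [TopologicalSpace N] [ChartedSpace H' N] {f : M → N} {U : Set M} (hU : IsOpen U)
    (h : ∀ (n : ℕ) (c : EuclideanSpace ℝ (Fin n) → M),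
      ContMDiff 𝓘(ℝ, EuclideanSpace ℝ (Fin n)) 𝓘(ℝ, E) ∞ c → (∀ z, c z ∈ U) →
        ContMDiff 𝓘(ℝ, EuclideanSpace ℝ (Fin n)) I' ∞ (f ∘ c)) :
    ContMDiffOn 𝓘(ℝ, E) I' ∞ f U := by
  intro x hx
  let φ := chartAt E x
  let e : E ≃L[ℝ] EuclideanSpace ℝ (Fin (Module.finrank ℝ E)) := toEuclidean
  have hV : IsOpen (e.symm ⁻¹' (φ.target ∩ φ.symm ⁻¹' U)) :=
    (φ.symm.isOpen_inter_preimage hU).preimage e.symm.continuous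
  have hxV : e (φ x) ∈ e.symm ⁻¹' (φ.target ∩ φ.symm ⁻¹' U) := by
    have h1 : φ.symm (φ x) = x := φ.left_inv (mem_chart_source E x)
    simp only [Set.mem_preimage, ContinuousLinearEquiv.symm_apply_apply, Set.mem_inter_iff, h1]
    exact ⟨φ.map_source (mem_chart_source E x), hx⟩
  obtain ⟨c, d, W, hW, hxW, hc, hcV, hd, hcd⟩ := exists_ball_reparam hV hxV
  have hplot : ContMDiff 𝓘(ℝ, EuclideanSpace ℝ (Fin (Module.finrank ℝ E))) 𝓘(ℝ, E) ∞
      fun z => φ.symm (e.symm (c z)) := by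
    have h1 : ContMDiffOn 𝓘(ℝ, E) 𝓘(ℝ, E) ∞ φ.symm φ.target := contMDiffOn_chart_symm
    exact h1.comp_contMDiff ((e.symm.contDiff.comp hc).contMDiff) fun z => (hcV z).1
  have hfc := h _ _ hplot fun z => (hcV z).2
  have hφ : ContMDiffOn 𝓘(ℝ, E) 𝓘(ℝ, E) ∞ φ φ.source := contMDiffOn_chart
  have hO : IsOpen (φ.source ∩ φ ⁻¹' (e ⁻¹' W)) :=
    φ.isOpen_inter_preimage (hW.preimage e.continuous)
  have hinv : ContMDiffOn 𝓘(ℝ, E) 𝓘(ℝ, EuclideanSpace ℝ (Fin (Module.finrank ℝ E))) ∞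
      (fun y => d (e (φ y))) (φ.source ∩ φ ⁻¹' (e ⁻¹' W)) :=
    hd.contMDiffOn.comp (e.contDiff.contMDiff.comp_contMDiffOn (hφ.mono Set.inter_subset_left))
      fun y hy => hy.2
  have hloc : ContMDiffOn 𝓘(ℝ, E) I' ∞ f (φ.source ∩ φ ⁻¹' (e ⁻¹' W)) :=
    (hfc.comp_contMDiffOn hinv).congr fun y hy => by
      have h1 : φ.symm (φ y) = y := φ.left_inv hy.1
      simp [hcd _ hy.2, h1]
  exact (hloc.contMDiffAt (hO.mem_nhds ⟨mem_chart_source E x, hxW⟩)).contMDiffWithinAt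

theorem dSmooth_toFrame : DSmooth (toFrame g) :=
  PrincipalSpace.dSmooth_quotient fun _ _ h => Frame.smooth_act h

theorem toFrame_actOb (a : (twoFrame g).Ob) (k : Lorentz p q) :
    toFrame g (@TwoSpaceOver.actOb _ _ (manifoldDiffeology 𝓘(ℝ, E) M) (twoFrame g) a k) =
      (toFrame g a).act k := by
  obtain ⟨⟨φ, l⟩, rfl⟩ := Quotient.exists_rep a
  rfl

theorem Frame.frameAt_act (φ : Frame g) (k : Lorentz p q) (x : M) (h : φ.pt = x) (w : Rpq p q) :
    (φ.act k).frameAt x h w = φ.frameAt x h (toEnd k w) := by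
  subst h
  rfl

theorem Frame.frameAt_congr {φ ψ : Frame g} (e : φ = ψ) (x : M) (h : φ.pt = x) (h' : ψ.pt = x) :
    φ.frameAt x h = ψ.frameAt x h' := by
  subst e
  rfl

variable (g) in
/-- A local trivialization of the 2-frame 2-bundle, where `M` carries its manifold diffeology. -/
abbrev FrameTriv := @LocalTriv (Poinc p q) M _ (manifoldDiffeology 𝓘(ℝ, E) M) (twoFrame g)

namespace FrameTriv

/-- The domain of a local trivialization of the 2-frame 2-bundle. -/
abbrev domain (t : FrameTriv g) : Set M :=
  @LocalTriv.U _ _ _ (manifoldDiffeology 𝓘(ℝ, E) M) _ t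

/-- The orthonormal frame corresponding to the object `t⁻¹(x, 1)`. -/
def frame (t : FrameTriv g) (x : M) (hx : x ∈ t.domain) : Frame g :=
  toFrame g (@LocalTriv.sect _ _ _ (manifoldDiffeology 𝓘(ℝ, E) M) _ t x hx)

theorem frame_pt (t : FrameTriv g) {x : M} (hx : x ∈ t.domain) : (t.frame x hx).pt = x :=
  (toFrame_pt g _).trans (@LocalTriv.proj_sect _ _ _ (manifoldDiffeology 𝓘(ℝ, E) M) _ t x hx)

theorem localFrame_eq (t : FrameTriv g) {x : M} (hx : x ∈ t.domain) : localFrame g t x =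
    ((t.frame x hx).frameAt x (t.frame_pt hx) : Rpq p q →L[ℝ] TangentSpace 𝓘(ℝ, E) x) := by
  rw [localFrame, dif_pos hx]
  rfl

/-- The frame of any local trivialization is smooth, because the inverse of the trivialization
is. -/
theorem isOrthonormalFrameOn [FiniteDimensional ℝ E] (t : FrameTriv g) :
    IsOrthonormalFrameOn g (localFrame g t) t.domain where
  isOpen := @LocalTriv.isOpen _ _ _ (manifoldDiffeology 𝓘(ℝ, E) M) _ t
  isInvertible x hx := ⟨_, (t.localFrame_eq hx).symm⟩
  isometry x hx u v := by
    rw [t.localFrame_eq hx]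
    exact Frame.frameAt_isometry _ _ _ _ _
  smooth w := by
    let _ : DiffeologicalSpace M := manifoldDiffeology 𝓘(ℝ, E) M
    refine contMDiffOn_of_forall_plot (LocalTriv.isOpen t) fun n c hc hcU => ?_
    have h1 : IsPlot fun z => (⟨c z, hcU z⟩ : {x : M // x ∈ t.domain}) := fun _ => hc
    have h2 := dSmooth_toFrame (g := g) n _ (LocalTriv.dSmooth_sect t n _ h1)
    refine (Frame.isPlot_iff.1 h2 w).congr fun z => ?_
    simp only [Function.comp_apply]
    rw [t.localFrame_eq (hcU z)]
    exact (Frame.eval_frameAt _ _ _ _).symm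

theorem localFrame_transition (t t' : FrameTriv g) {x : M} (hx : x ∈ t.domain)
    (hx' : x ∈ t'.domain) : localFrame g t' x = localFrame g t x ∘L
      toEnd (@LocalTriv.transition _ _ _ (manifoldDiffeology 𝓘(ℝ, E) M) _ t t' x) := by
  let _ : DiffeologicalSpace M := manifoldDiffeology 𝓘(ℝ, E) M
  rw [t.localFrame_eq hx, t'.localFrame_eq hx']
  ext1 w
  have e : t'.frame x hx' = (t.frame x hx).act (LocalTriv.transition t t' x) :=
    (congrArg (toFrame g) (LocalTriv.sect_eq_actOb t t' hx hx')).trans (toFrame_actOb _ _)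
  rw [Frame.frameAt_congr e x _ (t.frame_pt hx)]
  exact Frame.frameAt_act _ _ _ _ _

end FrameTriv

end FramesOfTrivializations

/-! ### Existence of local orthonormal frames -/

section SquareRoots

/-- Elements near `1` of a subspace `S` that contains `1` and is closed under squaring have smooth
square roots in `S`, by the inverse function theorem for the squaring map of `S`. The square root
is extended to a map of the whole algebra by composing with a projection to `S`. -/
theorem exists_smooth_sqrt {A : Type*} [NormedRing A] [NormedAlgebra ℝ A] [FiniteDimensional ℝ A]
    (S : Submodule ℝ A) (h1S : (1 : A) ∈ S) (hS : ∀ a ∈ S, a * a ∈ S) :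
    ∃ r : A → A, ∀ᶠ a in 𝓝 (1 : A), ContDiffAt ℝ ∞ r a ∧
      (a ∈ S → r a ∈ S ∧ r a * r a = a ∧ IsUnit (r a)) := by
  have := FiniteDimensional.complete ℝ A
  let one : S := ⟨1, h1S⟩
  obtain ⟨P, hP⟩ := Submodule.ClosedComplemented.of_finiteDimensional S
  have hPone : P 1 = one := hP one
  let sq : S → S := fun a => P (a.1 * a.1)
  have hsq : ∀ a : S, (sq a).1 = a.1 * a.1 := fun a =>
    congrArg Subtype.val (hP ⟨a.1 * a.1, hS _ a.2⟩)
  have hone : sq one = one := Subtype.ext ((hsq one).trans (one_mul 1))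
  have hval : ContDiff ℝ ω fun a : S => a.1 := S.subtypeL.contDiff
  have hsm : ContDiff ℝ ω sq := P.contDiff.comp (hval.mul hval)
  let f' : S ≃L[ℝ] S := ContinuousLinearEquiv.smulLeft (Units.mk0 (2 : ℝ) two_ne_zero)
  have hf' : HasFDerivAt sq (f' : S →L[ℝ] S) one := by
    have h1 : HasFDerivAt (fun a : S => a.1) S.subtypeL one := S.subtypeL.hasFDerivAt
    have h2 := P.hasFDerivAt.comp one (h1.mul' h1)
    refine h2.congr_fderiv ?_
    ext1 a
    have h3 : P (a.1 + a.1) = a + a := hP (a + a)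
    have h4 : f' a = a + a := two_smul ℝ a
    simpa [one, h4] using h3
  have h0 : (ω : ℕ∞ω) ≠ 0 := by simp
  have h := hsm.contDiffAt (x := one)
  let r : S → S := h.localInverse hf' h0
  -- The inverse function theorem applies at `1`, where the derivative of `sq` is twice the
  -- identity; `r` is the local inverse of `sq` there.
  have e0 : P 1 = sq one := hPone.trans hone.symm
  have e1 : ∀ᶠ b in 𝓝 (P 1), sq (r b) = b := by
    rw [e0]
    exact (h.hasStrictFDerivAt' hf' h0).eventually_right_inverse
  have e2 : ∀ᶠ b in 𝓝 (P 1), ContDiffAt ℝ ω r b := by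
    rw [e0]
    exact (h.to_localInverse hf' h0).eventually (by simp)
  refine ⟨fun a => (r (P a)).1, ?_⟩
  filter_upwards [P.continuous.continuousAt.eventually e1, P.continuous.continuousAt.eventually e2,
    Units.isOpen.mem_nhds isUnit_one] with a h1 h2 h3
  refine ⟨(hval.contDiffAt.comp (P a) h2).of_le le_top |>.comp a P.contDiff.contDiffAt,
    fun ha => ?_⟩
  have h4 : (r (P a)).1 * (r (P a)).1 = a := by
    refine (hsq _).symm.trans ((congrArg Subtype.val h1).trans ?_)
    exact congrArg Subtype.val (hP ⟨a, ha⟩)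
  refine ⟨(r (P a)).2, h4, (isUnit_pow_iff two_ne_zero).1 ?_⟩
  rw [pow_two, h4]
  exact h3

end SquareRoots

section SelfAdjoint

variable {p q : ℕ}

theorem eta_eq_sum (u v : Rpq p q) :
    eta u v = ∑ a, Sum.elim (fun _ => 1) (fun _ => -1) a * u a * v a := by
  simp [eta, Fintype.sum_sum_type, sub_eq_add_neg]

theorem eq_of_forall_eta {u v : Rpq p q} (h : ∀ w, eta u w = eta v w) : u = v := by
  ext (i | j)
  · simpa only [Frame.eta_single_inl] using h (EuclideanSpace.single (Sum.inl i) 1)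
  · simpa only [Frame.eta_single_inr, neg_inj] using h (EuclideanSpace.single (Sum.inr j) 1)

variable (p q) in
/-- The endomorphisms of `ℝ^{p,q}` that are self-adjoint for `η`. -/
def etaSelfAdjoint : Submodule ℝ (Rpq p q →L[ℝ] Rpq p q) where
  carrier := {A | ∀ u v, eta (A u) v = eta u (A v)}
  zero_mem' u v := by simp [eta]
  add_mem' {A B} hA hB u v := by
    have h1 := hA u v
    have h2 := hB u v
    simp only [eta_eq_sum, add_apply, PiLp.add_apply, mul_add, add_mul,
      Finset.sum_add_distrib] at *
    rw [h1, h2]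
  smul_mem' c A hA u v := by
    have h1 := hA u v
    simp only [eta_eq_sum] at h1
    simp only [eta_eq_sum, smul_apply, PiLp.smul_apply, smul_eq_mul]
    have h2 := congrArg (c * ·) h1
    simp only [Finset.mul_sum] at h2
    convert h2 using 2 <;> ring

theorem one_mem_etaSelfAdjoint : (1 : Rpq p q →L[ℝ] Rpq p q) ∈ etaSelfAdjoint p q :=
  fun _ _ => rfl

theorem mul_self_mem_etaSelfAdjoint {A : Rpq p q →L[ℝ] Rpq p q} (hA : A ∈ etaSelfAdjoint p q) :
    A * A ∈ etaSelfAdjoint p q := fun u v => (hA (A u) v).trans (hA u (A v))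

theorem isInvertible_of_isUnit {A : Rpq p q →L[ℝ] Rpq p q} (hA : IsUnit A) : A.IsInvertible := by
  obtain ⟨a, rfl⟩ := hA
  exact ⟨ContinuousLinearEquiv.unitsEquiv ℝ (Rpq p q) a, rfl⟩

end SelfAdjoint

section LocalFrameExistence

variable {p q : ℕ} {E : Type*} [NormedAddCommGroup E] [NormedSpace ℝ E]
  {M : Type*} [TopologicalSpace M] [ChartedSpace E M] [IsManifold 𝓘(ℝ, E) ∞ M]

/-- Every frame at a point extends to a smooth local frame, which has constant coefficients in a
trivialization of the tangent bundle. -/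
theorem exists_smooth_frame_extension (x : M) (f : Rpq p q ≃L[ℝ] TangentSpace 𝓘(ℝ, E) x) :
    ∃ (φ : (y : M) → Rpq p q →L[ℝ] TangentSpace 𝓘(ℝ, E) y) (U : Set M), IsOpen U ∧ x ∈ U ∧
      φ x = f ∧ (∀ y ∈ U, (φ y).IsInvertible) ∧ ∀ w, SmoothFieldOn (fun y => φ y w) U := by
  let e := trivializationAt E (TangentSpace 𝓘(ℝ, E) (M := M)) x
  have hx : x ∈ e.baseSet := FiberBundle.mem_baseSet_trivializationAt' x
  have h1 : ∀ y (hy : y ∈ e.baseSet) v, e.symmL ℝ y v = (e.continuousLinearEquivAt ℝ y hy).symm v :=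
    fun y hy v => congrFun (e.symm_continuousLinearEquivAt_eq hy).symm v
  refine ⟨fun y => e.symmL ℝ y ∘L (f.trans (e.continuousLinearEquivAt ℝ x hx) : Rpq p q →L[ℝ] E),
    e.baseSet, e.open_baseSet, hx, ?_, fun y hy => ?_, fun w => ?_⟩
  · ext1 w
    exact (h1 x hx _).trans ((e.continuousLinearEquivAt ℝ x hx).symm_apply_apply (f w))
  · exact ⟨(f.trans (e.continuousLinearEquivAt ℝ x hx)).trans
      (e.continuousLinearEquivAt ℝ y hy).symm, by ext1 w; exact (h1 y hy _).symm⟩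
  · have h2 := e.contMDiffOn_symmL (n := ∞) (IB := 𝓘(ℝ, E)) (𝕜 := ℝ)
    have h3 : ContMDiffOn 𝓘(ℝ, E) (𝓘(ℝ, E).prod 𝓘(ℝ, E)) ∞
        (fun y => TotalSpace.mk' E (E := Bundle.Trivial M E) y
          (e.continuousLinearEquivAt ℝ x hx (f w))) e.baseSet :=
      fun y _ =>
        ((Bundle.contMDiffAt_totalSpace (f := fun y => TotalSpace.mk' E (E := Bundle.Trivial M E) y
          (e.continuousLinearEquivAt ℝ x hx (f w)))).2
            ⟨contMDiffAt_id, contMDiffAt_const⟩).contMDiffWithinAt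
    exact ContMDiffOn.clm_bundle_apply (F₁ := E) (E₁ := Bundle.Trivial M E)
      (v := fun _ => e.continuousLinearEquivAt ℝ x hx (f w)) h2 h3

variable (g : SemiRiemannianMetric p q E M)

/-- The endomorphism `H` of `ℝ^{p,q}` that describes the metric at `x` in a frame `φ` in terms of
`η`: `g(φ u, φ v) = η(H u, v)`. -/
def gramOperator (x : M) (φ : Rpq p q →L[ℝ] TangentSpace 𝓘(ℝ, E) x) : Rpq p q →L[ℝ] Rpq p q :=
  ∑ a, (g.inner x (φ (EuclideanSpace.single a 1)) ∘L φ).smulRight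
    ((Sum.elim (fun _ => 1) (fun _ => -1) a : ℝ) • EuclideanSpace.single a (1 : ℝ))

theorem eta_gramOperator (x : M) (φ : Rpq p q →L[ℝ] TangentSpace 𝓘(ℝ, E) x) (u v : Rpq p q) :
    eta (gramOperator g x φ u) v = g.inner x (φ u) (φ v) := by
  have h1 : ∀ a, gramOperator g x φ u a = (Sum.elim (fun _ => 1) (fun _ => -1) a : ℝ) *
      g.inner x (φ (EuclideanSpace.single a 1)) (φ u) := fun a => by
    rcases a with i | j <;> simp [gramOperator, Pi.single_apply]
  rw [g.symm, map_eq_sum_coord φ v, map_sum, sum_apply, eta_eq_sum]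
  refine Finset.sum_congr rfl fun a _ => ?_
  rw [h1, map_smul, smul_apply, smul_eq_mul]
  rcases a with i | j <;> simp [mul_comm]

theorem gramOperator_mem_etaSelfAdjoint (x : M) (φ : Rpq p q →L[ℝ] TangentSpace 𝓘(ℝ, E) x) :
    gramOperator g x φ ∈ etaSelfAdjoint p q := fun u v => by
  rw [eta_gramOperator, eta_comm, eta_gramOperator, g.symm]

theorem contMDiffOn_gramOperator {φ : (x : M) → Rpq p q →L[ℝ] TangentSpace 𝓘(ℝ, E) x} {U : Set M}
    (hφ : ∀ w, SmoothFieldOn (fun y => φ y w) U) :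
    ContMDiffOn 𝓘(ℝ, E) 𝓘(ℝ, Rpq p q →L[ℝ] Rpq p q) ∞ (fun x => gramOperator g x (φ x)) U := by
  refine contMDiffOn_clm_of_apply fun w => ?_
  have h : ContMDiffOn 𝓘(ℝ, E) 𝓘(ℝ, Rpq p q) ∞ (fun x => ∑ a,
      g.inner x (φ x (EuclideanSpace.single a 1)) (φ x w) •
      ((Sum.elim (fun _ => 1) (fun _ => -1) a : ℝ) • EuclideanSpace.single a (1 : ℝ))) U :=
    contMDiffOn_finsetSum fun a _ =>
      (contMDiffOn_metric (hφ (EuclideanSpace.single a 1)) (hφ w)).smul contMDiffOn_const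
  refine h.congr fun x _ => ?_
  simp [gramOperator]

/-- Smooth orthonormal frames exist near every point: with `H` the Gram operator of a smooth frame
`φ` and `R` a self-adjoint square root of `H`, the frame `φ R⁻¹` is orthonormal. -/
theorem exists_isOrthonormalFrameOn (x : M) :
    ∃ (s : (y : M) → Rpq p q →L[ℝ] TangentSpace 𝓘(ℝ, E) y) (U : Set M), x ∈ U ∧
      IsOrthonormalFrameOn g s U := by
  obtain ⟨f, hf⟩ := g.signature x
  obtain ⟨φ, U, hU, hx, hφx, hφ, hφs⟩ := exists_smooth_frame_extension x f
  obtain ⟨r, hr⟩ := exists_smooth_sqrt (etaSelfAdjoint p q) one_mem_etaSelfAdjoint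
    fun _ => mul_self_mem_etaSelfAdjoint
  let H : M → Rpq p q →L[ℝ] Rpq p q := fun y => gramOperator g y (φ y)
  have hHS : ∀ y, H y ∈ etaSelfAdjoint p q := fun y => gramOperator_mem_etaSelfAdjoint g y (φ y)
  have hH : ContMDiffOn 𝓘(ℝ, E) 𝓘(ℝ, Rpq p q →L[ℝ] Rpq p q) ∞ H U :=
    contMDiffOn_gramOperator g hφs
  have hHx : H x = 1 := by
    refine ContinuousLinearMap.ext fun u => eq_of_forall_eta fun v => ?_
    rw [eta_gramOperator, hφx]
    exact hf u v
  rw [← hHx] at hr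
  obtain ⟨N, hN, hNo, hxN⟩ := eventually_nhds_iff.1 hr
  have hO : IsOpen (U ∩ H ⁻¹' N) := hH.continuousOn.isOpen_inter_preimage hU hNo
  have hinv : ∀ y ∈ U ∩ H ⁻¹' N, (r (H y)).IsInvertible := fun y hy =>
    isInvertible_of_isUnit ((hN _ hy.2).2 (hHS y)).2.2
  have hR : ContMDiffOn 𝓘(ℝ, E) 𝓘(ℝ, Rpq p q →L[ℝ] Rpq p q) ∞
      (fun y => ContinuousLinearMap.inverse (r (H y))) (U ∩ H ⁻¹' N) := by
    intro y hy
    obtain ⟨k, hk⟩ := hinv y hy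
    have h3 : ContDiffAt ℝ ∞ ContinuousLinearMap.inverse (r (H y)) := by
      rw [← hk]
      exact contDiffAt_map_inverse k
    exact (h3.comp (H y) (hN _ hy.2).1).contMDiffAt.comp_contMDiffWithinAt y
      ((hH y hy.1).mono Set.inter_subset_left)
  refine ⟨fun y => φ y ∘L ContinuousLinearMap.inverse (r (H y)), U ∩ H ⁻¹' N, ⟨hx, hxN⟩, hO,
    fun y hy => (hφ y hy.1).comp (hinv y hy).inverse, fun y hy u v => ?_, fun w => ?_⟩
  · obtain ⟨h1, h2, -⟩ := (hN _ hy.2).2 (hHS y)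
    simp only [ContinuousLinearMap.comp_apply]
    rw [← eta_gramOperator]
    change eta (H y _) _ = _
    -- `g(φ R⁻¹ u, φ R⁻¹ v) = η(R R R⁻¹ u, R⁻¹ v) = η(R R⁻¹ u, R R⁻¹ v)`, as `R` is self-adjoint.
    have h4 : ∀ w, H y w = r (H y) (r (H y) w) := fun w => (DFunLike.congr_fun h2 w).symm
    rw [h4, (hinv y hy).self_apply_inverse, h1, (hinv y hy).self_apply_inverse]
  · refine smoothFieldOn_clm_apply (fun w => (hφs w).mono Set.inter_subset_left) ?_
    exact (ContinuousLinearMap.apply ℝ (Rpq p q) w).contMDiff.comp_contMDiffOn hR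

end LocalFrameExistence

/-! ### Local triviality of the 2-frame 2-bundle -/

section TwoFrameBundle

variable {p q : ℕ} {E : Type*} [NormedAddCommGroup E] [NormedSpace ℝ E]
  {M : Type*} [TopologicalSpace M] [ChartedSpace E M] [IsManifold 𝓘(ℝ, E) ∞ M]
  {g : SemiRiemannianMetric p q E M}

/-- The section of the frame bundle given by a local orthonormal frame. -/
def IsOrthonormalFrameOn.frameSection {s : (x : M) → Rpq p q →L[ℝ] TangentSpace 𝓘(ℝ, E) x}
    {U : Set M} (hs : IsOrthonormalFrameOn g s U) (x : {x : M // x ∈ U}) : Frame g where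
  pt := x
  frame := (hs.isInvertible x x.2).choose
  isometry u v := by
    have h : ∀ w, (hs.isInvertible x x.2).choose w = s x w :=
      DFunLike.congr_fun (hs.isInvertible x x.2).choose_spec
    rw [h, h]
    exact hs.isometry x x.2 u v

theorem IsOrthonormalFrameOn.isPlot_frameSection
    {s : (x : M) → Rpq p q →L[ℝ] TangentSpace 𝓘(ℝ, E) x} {U : Set M}
    (hs : IsOrthonormalFrameOn g s U) {n : ℕ} {c : EuclideanSpace ℝ (Fin n) → {x : M // x ∈ U}}
    (hc : ContMDiff 𝓘(ℝ, EuclideanSpace ℝ (Fin n)) 𝓘(ℝ, E) ∞ fun z => (c z : M)) :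
    IsPlot fun z => hs.frameSection (c z) := by
  refine Frame.isPlot_iff.2 fun w => ?_
  have h1 : ContMDiffOn 𝓘(ℝ, E) 𝓘(ℝ, E).tangent ∞
      (fun x => (⟨x, s x w⟩ : TangentBundle 𝓘(ℝ, E) M)) U := hs.smooth w
  refine (h1.comp_contMDiff hc fun z => (c z).2).congr fun z => ?_
  exact congrArg (TotalSpace.mk' E (c z : M))
    (DFunLike.congr_fun (hs.isInvertible _ (c z).2).choose_spec w)

variable (g) in
/-- The 2-frame 2-bundle is locally trivial, since smooth orthonormal frames exist locally. -/
theorem isPrincipal2Bundle_twoFrame : letI := manifoldDiffeology 𝓘(ℝ, E) M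
    (twoFrame g).IsPrincipal2Bundle := by
  let _ : DiffeologicalSpace M := manifoldDiffeology 𝓘(ℝ, E) M
  intro x
  obtain ⟨s, U, hx, hs⟩ := exists_isOrthonormalFrameOn g x
  exact ⟨(frameBundle g).localTrivOfSection hs.isOpen hs.frameSection (fun _ => rfl)
    fun _ _ h => hs.isPlot_frameSection (h ()), hx⟩

end TwoFrameBundle

end HigherGauge

end

theorem mainTheorem3 (p q : ℕ) {E : Type*} [NormedAddCommGroup E] [NormedSpace ℝ E]
    [FiniteDimensional ℝ E] {M : Type*} [TopologicalSpace M] [T2Space M] [ChartedSpace E M]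
    [IsManifold 𝓘(ℝ, E) ∞ M] (g : SemiRiemannianMetric p q E M)
    (D : CovariantDerivative 𝓘(ℝ, E) E (TangentSpace 𝓘(ℝ, E) : M → Type _))
    [CovariantDerivative.ContMDiffCovariantDerivative D ∞]
    (hflat : IsFlatConnection D) (hmetric : IsMetricCompatible g D) :
    letI : DiffeologicalSpace M := manifoldDiffeology 𝓘(ℝ, E) M
    IsStrict2Connection (twoFrame g) (localFormsOf g D D.torsion) ∧
      (localFormsOf g D D.torsion).IsFlat := by
  let _ : DiffeologicalSpace M := manifoldDiffeology 𝓘(ℝ, E) M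
  have hframe : ∀ t : FrameTriv g, IsOrthonormalFrameOn g (localFrame g t) t.domain :=
    fun t => t.isOrthonormalFrameOn
  refine ⟨⟨isPrincipal2Bundle_twoFrame g, fun t x hx v => ?_, fun t x hx v => ?_,
    fun t X hX => ?_, fun t X Y hX hY => ?_, fun t X Y hX hY x hx => ?_,
    fun t t' x hx v => ?_, fun t t' x hx v w => ?_⟩, fun t X Y hX hY x hx => ?_,
    fun t X Y Z hX hY hZ x hx => ?_⟩
  · exact (hframe t).connectionForm_mem_lorentzAlgebra hmetric hx v
  · change ContinuousLinearMap.inverse (localFrame g t x) (D.torsion x v v) = 0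
    rw [D.torsion_self, map_zero]
  · exact (hframe t).contMDiffOn_connectionForm hX
  · exact (hframe t).contMDiffOn_inverse (smoothField_torsion hX hY).smoothFieldOn
  · -- The differential of the target homomorphism is zero.
    exact (hframe t).curvatureForm_connectionForm hflat hX hY hx
  · exact (hframe t).connectionForm_gauge (hframe t')
      (fun y hy => FrameTriv.localFrame_transition t t' hy.1 hy.2) hx v
  · exact (hframe t).inverse_apply_gauge (hframe t')
      (FrameTriv.localFrame_transition t t' hx.1 hx.2) hx _
  · exact (hframe t).curvatureForm_connectionForm hflat hX hY hx
  · exact (hframe t).twoCurvatureForm_torsion hflat hX hY hZ hx
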